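/- Conventions. A superform on $\mathbb R^n$ is a differential form in $(x,\xi)\in\mathbb R^n\oplus\mathbb R^n$, $\sum a_{I,J}(x)\,dx_I\wedge d\xi_J$, whose coefficients depend only on $x$; it has bidegree $(p,q)$ if $|I|=p$, $|J|=q$. For a superform $a$ put $da=\sum_k dx_k\wedge\partial a/\partial x_k$, $d^{\#}a=\sum_k d\xi_k\wedge\partial a/\partial x_k$. Let $J$ be the algebra map with $J(dx_i)=d\xi_i$, $J(d\xi_i)=-dx_i$, write $\alpha^{\#}=J\alpha$ for a $(1,0)$-form $\alpha$, and $\beta=\sum_j dx_j\wedge d\xi_j$. A supercurrent of bidimension $(m,m)$ on an open set $D$ is a continuous linear functional on the smooth compactly supported superforms of bidegree $(m,m)$ on $D$. It is positive if $T.(\alpha_1\wedge\alpha_1^{\#}\wedge\dots\wedge\alpha_m\wedge\alpha_m^{\#})\ge 0$ for all smooth compactly supported $(1,0)$-forms $\alpha_j$ on $D$, symmetric if $T.(J\varphi)=T.\varphi$ for all $\varphi$, and minimal if it is positive, symmetric and $d(T\wedge\beta^{m-1})=0$, i.e. $T.(\beta^{m-1}\wedge d\eta)=0$ for all smooth compactly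 supported $(0,1)$-forms $\eta$ on $D$. For positive $T$ and $U\subseteq D$ open, $\int_U T\wedge\beta^m/m!$ denotes the mass on $U$ of the positive measure $\chi\mapsto T.(\chi\beta^m/m!)$. A (constant) form of bidegree $(n-m,n-m)$, also called of bidimension $(m,m)$, is weakly positive if its wedge product with every $\alpha_1\wedge\alpha_1^{\#}\wedge\dots\wedge\alpha_m\wedge\alpha_m^{\#}$ is a nonnegative multiple of $\beta^n/n!$. A locally integrable function $u$ on $D$ is $m$-subharmonic if $dd^{\#}u\wedge\beta^{m-1}\wedge\alpha$ is a positive current for every such weakly positive $\alpha$. Theorem 6.3. Let $n\ge 0$ and $m\ge1$ be integers, let $D\subset\mathbb R^n$ be a smoothly bounded domain, let $a\in D$, and let $w:\overline D\to\mathbb R$ satisfy $w(x)=|x-a|^m$ for $x\in\partial D$. Assume that either (i) $w$ is convex on $\overline D$ (if $\overline D$ is not convex: convex along every line segment contained in $\overline D$), or (ii) $w$ is $m$-subharmonic in $D$, is at each point of $D$ the limit of its means over small balls centred there, and is upper semicontinuous on $\overline D$. Then for every minimal supercurrent $T$ of bidimension $(m,m)$ on $D$, the density $$\gamma_T(a)=\lim_{r\to0}r^{-m}\int_{|x-a|<r}T\wedge\beta^m/m!$$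 exists and is finite, and $$\int_D T\wedge\frac{\beta^m}{m!}\ \ge\ w(a)\,\gamma_T(a).$$ -/

import Mathlib

open Set Filter Topology MeasureTheory TopologicalSpace
open scoped NNReal ENNReal Distributions

namespace Super

noncomputable section

/-- Euclidean space `ℝⁿ`. -/
abbrev E (n : ℕ) : Type := EuclideanSpace ℝ (Fin n)

/-- Covectors of the superspace `ℝⁿ ⊕ ℝⁿ` in the coordinates `(x, ξ)`: the pair `(u, v)` is the
covector `∑ j, u j dx_j + ∑ j, v j dξ_j`. -/
abbrev Covec (n : ℕ) : Type := E n × E n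

/-- Values of superforms on `ℝⁿ` at a point: the exterior algebra on the superspace covectors;
its multiplication is the wedge product. A superform is a function `E n → Form n`, its
coefficients being functions of `x` alone. -/
abbrev Form (n : ℕ) : Type := ExteriorAlgebra ℝ (Covec n)

/-- The basis `dx_1, …, dx_n, dξ_1, …, dξ_n` of the covectors. -/
def covecBasis (n : ℕ) : Module.Basis (Fin (n + n)) ℝ (Covec n) :=
  (((EuclideanSpace.basisFun (Fin n) ℝ).toBasis.prod
    (EuclideanSpace.basisFun (Fin n) ℝ).toBasis)).reindex finSumFinEquiv

/-- The coefficients `a_{I,J}` of a form in the basis `dx_I ∧ dξ_J`. -/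
def coeffs (n : ℕ) : Form n ≃ₗ[ℝ] (Finset (Fin (n + n)) → ℝ) :=
  (covecBasis n).ExteriorAlgebra.equivFun

/-- The norm on forms is the largest coefficient; it only serves to speak of smoothness and of the
topology on test forms, which do not depend on the choice of the norm. -/
instance instNormedAddCommGroupForm (n : ℕ) : NormedAddCommGroup (Form n) :=
  NormedAddCommGroup.induced (Form n) (Finset (Fin (n + n)) → ℝ) (coeffs n) (coeffs n).injective

instance instNormedSpaceForm (n : ℕ) : NormedSpace ℝ (Form n) :=
  NormedSpace.induced ℝ (Form n) (Finset (Fin (n + n)) → ℝ) (coeffs n)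

variable {n : ℕ}

/-- The form `∑ j, u j dx_j`. -/
def formX : E n →ₗ[ℝ] Form n := ExteriorAlgebra.ι ℝ ∘ₗ LinearMap.inl ℝ (E n) (E n)

/-- The form `∑ j, u j dξ_j`; it is `(formX u)^#`. -/
def formXi : E n →ₗ[ℝ] Form n := ExteriorAlgebra.ι ℝ ∘ₗ LinearMap.inr ℝ (E n) (E n)

/-- The vector `e_j` of the standard basis. -/
def e (j : Fin n) : E n := EuclideanSpace.single j 1

/-- `dx_j`. -/
def dx (j : Fin n) : Form n := formX (e j)

/-- `dξ_j`. -/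
def dxi (j : Fin n) : Form n := formXi (e j)

variable (n) in
/-- The forms of bidegree `(p, q)`: the span of the products of `p` covectors `dx_i` and `q`
covectors `dξ_j`. -/
def bidegree (p q : ℕ) : Submodule ℝ (Form n) :=
  LinearMap.range (formX (n := n)) ^ p * LinearMap.range (formXi (n := n)) ^ q

/-- The complex structure on covectors, `J dx_j = dξ_j`, `J dξ_j = -dx_j`. -/
def covecJ : Covec n →ₗ[ℝ] Covec n :=
  LinearMap.prod (-LinearMap.snd ℝ (E n) (E n)) (LinearMap.fst ℝ (E n) (E n))

/-- The extension of `J` to forms, `J (a ∧ b) = J a ∧ J b`. -/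
def formJ : Form n →ₐ[ℝ] Form n := ExteriorAlgebra.map covecJ

variable (n) in
/-- The Euclidean Kähler form `β = ∑ j, dx_j ∧ dξ_j`. -/
def beta : Form n := ∑ j, dx j * dxi j

/-- The exterior derivative `df = ∑ k, dx_k ∧ ∂f/∂x_k`. -/
def extD (f : E n → Form n) (x : E n) : Form n := ∑ k, dx k * fderiv ℝ f x (e k)

/-- The operator `d^# f = ∑ k, dξ_k ∧ ∂f/∂x_k`. -/
def extDSharp (f : E n → Form n) (x : E n) : Form n := ∑ k, dxi k * fderiv ℝ f x (e k)

/-- `d d^# u` for a function `u`, that is, a superform of bidegree `(0, 0)`. -/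
def ddSharp (u : E n → ℝ) : E n → Form n :=
  extD (extDSharp fun x => algebraMap ℝ (Form n) (u x))

/-- The product `α_1 ∧ α_1^# ∧ ⋯ ∧ α_m ∧ α_m^#` of covectors `α_j = ∑ k, (α_j)_k dx_k`. -/
def sharpProd {m : ℕ} (α : Fin m → E n) : Form n :=
  (List.ofFn fun j => formX (α j) * formXi (α j)).prod

/-- Test forms of bidegree `(p, q)` on the open set `D`: smooth, with compact support in `D`. -/
abbrev TestForm (D : Opens (E n)) (p q : ℕ) : Type := 𝓓(D, bidegree n p q)

/-- Supercurrents of bidimension `(p, q)` on `D`: the dual of the space of test forms of bidegree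
`(p, q)`, with its usual topology. -/
abbrev Supercurrent (D : Opens (E n)) (p q : ℕ) : Type := TestForm D p q →L[ℝ] ℝ

namespace Supercurrent

variable {D : Opens (E n)} {m : ℕ}

/-- `T` is (weakly) positive: `T . α_1 ∧ α_1^# ∧ ⋯ ∧ α_m ∧ α_m^# ≥ 0` for all smooth compactly
supported `(1, 0)`-forms `α_j`. -/
def IsPositive (T : Supercurrent D m m) : Prop :=
  ∀ (α : Fin m → 𝓓(D, E n)) (φ : TestForm D m m),
    (∀ x, (φ x : Form n) = sharpProd fun j => α j x) → 0 ≤ T φ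

/-- `T` is symmetric: `J T = T`, that is, `T . J φ = T . φ`. -/
def IsSymmetric (T : Supercurrent D m m) : Prop :=
  ∀ φ ψ : TestForm D m m, (∀ x, (ψ x : Form n) = formJ (φ x : Form n)) → T ψ = T φ

/-- `d T ∧ β^{m-1} = d (T ∧ β^{m-1}) = 0`. The current `T ∧ β^{m-1}` has bidimension `(1, 1)`, so
its derivative acts on forms `η` of bidegree `(0, 1)`, as `η ↦ ± T . (β^{m-1} ∧ dη)`. -/
def IsClosedBeta (T : Supercurrent D m m) : Prop :=
  ∀ (η : TestForm D 0 1) (φ : TestForm D m m),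
    (∀ x, (φ x : Form n) = beta n ^ (m - 1) * extD (fun y => (η y : Form n)) x) → T φ = 0

/-- Minimal supercurrents: positive, symmetric, and `d T ∧ β^{m-1} = 0`. -/
structure IsMinimal (T : Supercurrent D m m) : Prop where
  positive : IsPositive T
  symmetric : IsSymmetric T
  closed : IsClosedBeta T

/-- The mass `∫_U T ∧ β^m / m!` of a positive supercurrent `T` on an open set `U`: the measure that
the positive functional `χ ↦ T . (χ β^m / m!)` gives to `U`, that is, the supremum of
`T . (χ β^m / m!)` over the test functions `0 ≤ χ ≤ 1` supported in `U`. -/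
def mass (T : Supercurrent D m m) (U : Set (E n)) : ℝ≥0∞ :=
  ⨆ (χ : 𝓓(D, ℝ)) (φ : TestForm D m m) (_ : ∀ x, 0 ≤ χ x ∧ χ x ≤ 1) (_ : tsupport χ ⊆ U)
    (_ : ∀ x, (φ x : Form n) = χ x • ((m.factorial : ℝ)⁻¹ • beta n ^ m)), ENNReal.ofReal (T φ)

/-- `T` has density `γ` at `a`: `γ = lim_{r → 0} r^{-m} ∫_{|x-a|<r} T ∧ β^m / m!`. -/
def HasDensity (T : Supercurrent D m m) (a : E n) (γ : ℝ≥0) : Prop :=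
  Tendsto (fun r : ℝ => mass T (Metric.ball a r) / ENNReal.ofReal (r ^ m)) (𝓝[>] 0)
    (𝓝 (γ : ℝ≥0∞))

end Supercurrent

/-- Smoothly bounded domains: bounded, connected, and near every boundary point `p` given as
`{ρ < 0}` for a smooth function `ρ` with `dρ(p) ≠ 0`. -/
structure IsSmoothlyBoundedDomain (D : Opens (E n)) : Prop where
  bounded : Bornology.IsBounded (D : Set (E n))
  connected : IsConnected (D : Set (E n))
  boundary : ∀ p ∈ frontier (D : Set (E n)), ∃ ρ : E n → ℝ, ContDiff ℝ (⊤ : ℕ∞) ρ ∧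
    fderiv ℝ ρ p ≠ 0 ∧ ∀ᶠ x in 𝓝 p, (x ∈ D ↔ ρ x < 0)

/-- `w` is convex along every line segment in `K`. If `K` is convex, then this is convexity of
`w` on `K`. -/
def ConvexAlongSegments (K : Set (E n)) (w : E n → ℝ) : Prop :=
  ∀ x y, segment ℝ x y ⊆ K → ConvexOn ℝ (segment ℝ x y) w

/-- A weakly positive (constant) form of bidimension `(m, m)`, given by its action
`ψ ↦ α ∧ ψ` on the covectors `ψ` of bidegree `(m, m)` (only the values on `bidegree n m m`
matter). -/
def IsWeaklyPositiveForm (m : ℕ) (α : Form n →ₗ[ℝ] ℝ) : Prop :=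
  ∀ v : Fin m → E n, 0 ≤ α (sharpProd v)

/-- `m`-subharmonic functions on `D`: locally integrable functions `u` such that
`d d^# u ∧ β^{m-1} ∧ α` is a positive current for every weakly positive form `α` of bidimension
`(m, m)`. It is enough to ask this for constant `α`: then `d d^# u ∧ β^{m-1}` has measure
coefficients, and positivity against `α` is decided at the individual points. For constant `α` the
derivatives fall on the test function `χ` alone. -/
def IsMSubharmonic (m : ℕ) (D : Opens (E n)) (u : E n → ℝ) : Prop :=
  LocallyIntegrableOn u (D : Set (E n)) volume ∧
  ∀ α : Form n →ₗ[ℝ] ℝ, IsWeaklyPositiveForm m α →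
    ∀ χ : 𝓓(D, ℝ), (∀ x, 0 ≤ χ x) →
      0 ≤ ∫ x in (D : Set (E n)), u x * α (ddSharp χ x * beta n ^ (m - 1))

/-- `m`-subharmonic functions on the closure of `D`: `m`-subharmonic in `D`, where the
value at each point is the limit of the means over small balls (this selects the function within
its class of locally integrable functions), and upper semicontinuous up to the boundary. -/
structure IsMSubharmonicOnClosure (m : ℕ) (D : Opens (E n)) (u : E n → ℝ) : Prop where
  mSubharmonic : IsMSubharmonic m D u
  tendsto_mean : ∀ x ∈ D,
    Tendsto (fun r : ℝ => ⨍ y in Metric.ball x r, u y) (𝓝[>] 0) (𝓝 (u x))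
  upperSemicontinuous : UpperSemicontinuousOn u (closure (D : Set (E n)))

end

end Super

open Set Filter Topology MeasureTheory TopologicalSpace
open scoped NNReal ENNReal Distributions ContDiff

namespace Super

noncomputable section

variable {n : ℕ}

/-! ### Algebra of superforms -/

/-! The estimate comes from testing `T` against one well-chosen exact form. Let `v` be smooth,
suppose that on `D` the set where `v > |x-a|^m` lies in a compact `K ⊆ D`, and let `dd^# v ∧
β^{m-1}` be weakly positive on `K`. Let `H` be a smooth version of `max(|x-a|, r)^m` and put `X = A
(x-a) + B ∇v`, where `A` is, up to smoothing, `-(v-H)₊/(mH)`. The function `B ≤ 0` is an integral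
chosen so that the mixed terms of `d(X^#)` are antisymmetric. Closedness of `T ∧ β^{m-1}` kills
`d(X^#) ∧ β^{m-1}`, and symmetry of `T` kills the mixed terms. The remaining terms have a sign: the
Hessian of `v` by assumption, `∇v ∧ ∇v^#` because it is a positive product, and the radial term by
the sharp inequality `m u ∧ u^# ∧ β^{m-1} ≤ |u|² β^m` (`pairForm_le`). This is `trace_le`: the
integral of about `(v - r^m)₊ / r^m` over the ball of radius `r` is at most the mass of part of `K`
outside that ball. Adding the mass of the ball gives `mass_ball_le`: if `v ≥ c` on the ball, then `c
r^{-m}` times its mass is at most the mass of the larger set.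

A constant `v` yields the monotonicity formula, hence the density (`exists_hasDensity`). For general
`v`, letting `r → 0` gives `v(a) γ ≤ mass(D)` (`mul_density_le`).

The function `w` is reached by mollifying it and subtracting a small constant
(`exists_smooth_minorant`). This requires that `w` be asymptotically at most `|x-a|^m` at the
boundary, by semicontinuity or by convexity along chords, and that mollification keep the sign of
`dd^# w ∧ β^{m-1}`.

Positivity of `T` is given only on products of smooth covector fields. `IsPositive.onForms_nonneg`
extends it to the test forms above, which are positive only pointwise against weakly positive forms.
-/

lemma formXi_mul_formX (u v : E n) : formXi u * formX v = -(formX v * formXi u) :=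
  eq_neg_of_add_eq_zero_left (ExteriorAlgebra.ι_add_mul_swap _ _)

lemma formX_mul_self (u : E n) : formX u * formX u = 0 :=
  ExteriorAlgebra.ι_sq_zero _

/-- The form `u ∧ v^#` of bidegree `(1, 1)`. -/
def pairForm (u v : E n) : Form n := formX u * formXi v

lemma pairForm_add_left (u u' v : E n) : pairForm (u + u') v = pairForm u v + pairForm u' v := by
  simp [pairForm, add_mul]

lemma pairForm_sub_left (u u' v : E n) : pairForm (u - u') v = pairForm u v - pairForm u' v := by
  simp [pairForm, sub_mul]

lemma pairForm_add_right (u v v' : E n) : pairForm u (v + v') = pairForm u v + pairForm u v' := by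
  simp [pairForm, mul_add]

lemma pairForm_smul_left (c : ℝ) (u v : E n) : pairForm (c • u) v = c • pairForm u v := by
  simp [pairForm]

lemma pairForm_smul_right (c : ℝ) (u v : E n) : pairForm u (c • v) = c • pairForm u v := by
  simp [pairForm]

lemma pairForm_sum_left {ι : Type*} (s : Finset ι) (u : ι → E n) (v : E n) :
    pairForm (∑ i ∈ s, u i) v = ∑ i ∈ s, pairForm (u i) v := by
  simp [pairForm, Finset.sum_mul]

lemma pairForm_sum_right {ι : Type*} (s : Finset ι) (u : E n) (v : ι → E n) :
    pairForm u (∑ i ∈ s, v i) = ∑ i ∈ s, pairForm u (v i) := by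
  simp [pairForm, Finset.mul_sum]

lemma pairForm_mul_self (u : E n) : pairForm u u * pairForm u u = 0 := by
  have : pairForm u u * pairForm u u = formX u * (formXi u * formX u) * formXi u := by
    simp only [pairForm, mul_assoc]
  rw [this, formXi_mul_formX, mul_neg, neg_mul, ← mul_assoc, formX_mul_self]
  simp

lemma commute_ι_mul_ι (x y z : Covec n) :
    Commute (ExteriorAlgebra.ι ℝ x * ExteriorAlgebra.ι ℝ y) (ExteriorAlgebra.ι ℝ z) := by
  have h1 : ExteriorAlgebra.ι ℝ y * ExteriorAlgebra.ι ℝ z =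
      -(ExteriorAlgebra.ι ℝ z * ExteriorAlgebra.ι ℝ y) :=
    eq_neg_of_add_eq_zero_left (ExteriorAlgebra.ι_add_mul_swap _ _)
  have h2 : ExteriorAlgebra.ι ℝ x * ExteriorAlgebra.ι ℝ z =
      -(ExteriorAlgebra.ι ℝ z * ExteriorAlgebra.ι ℝ x) :=
    eq_neg_of_add_eq_zero_left (ExteriorAlgebra.ι_add_mul_swap _ _)
  rw [Commute, SemiconjBy, mul_assoc, h1, mul_neg, ← mul_assoc, h2, neg_mul, neg_neg, mul_assoc]

lemma commute_pairForm (u v : E n) (z : Form n) : Commute (pairForm u v) z := by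
  induction z using ExteriorAlgebra.induction with
  | algebraMap r => exact (Algebra.commutes r _).symm
  | ι x => exact commute_ι_mul_ι _ _ _
  | mul a b ha hb => exact ha.mul_right hb
  | add a b ha hb => exact ha.add_right hb

lemma beta_eq_sum_pairForm : beta n = ∑ j, pairForm (e j) (e j) := rfl

lemma commute_beta (z : Form n) : Commute (beta n) z :=
  Finset.sum_induction _ (fun w => Commute w z) (fun _ _ => Commute.add_left)
    (Commute.zero_left z) fun _ _ => commute_pairForm _ _ _

/-- Parseval: the matrix of inner products between two orthonormal bases is orthogonal. This allows
a given unit vector to be split off from `β`. -/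
lemma beta_eq_sum_orthonormalBasis {ι : Type*} [Fintype ι] (b : OrthonormalBasis ι ℝ (E n)) :
    beta n = ∑ i, pairForm (b i) (b i) := by
  have h : ∀ i, b i = ∑ j, inner ℝ (e j) (b i) • (e j : E n) := fun i => by
    conv_lhs => rw [← (EuclideanSpace.basisFun (Fin n) ℝ).sum_repr' (b i)]
    simp [e]
  have h2 : ∀ j k : Fin n, ∑ i, inner ℝ (e j) (b i) * inner ℝ (e k) (b i) =
      if j = k then (1 : ℝ) else 0 := fun j k => by
    simp_rw [real_inner_comm (b _) (e k)]
    rw [b.sum_inner_mul_inner]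
    simp [e, EuclideanSpace.inner_single_left]
  calc beta n = ∑ j, ∑ k, (if j = k then (1 : ℝ) else 0) • pairForm (e j) (e k) := by
        simp [beta_eq_sum_pairForm]
    _ = ∑ j, ∑ k, ∑ i, (inner ℝ (e j) (b i) * inner ℝ (e k) (b i)) • pairForm (e j) (e k) := by
        simp_rw [← h2, Finset.sum_smul]
    _ = ∑ i, pairForm (b i) (b i) := by
        rw [Finset.sum_congr rfl fun j _ => Finset.sum_comm, Finset.sum_comm]
        refine Finset.sum_congr rfl fun i _ => ?_
        conv_rhs => rw [h i]
        simp_rw [pairForm_sum_left, pairForm_sum_right, pairForm_smul_left, pairForm_smul_right,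
          smul_smul]

/-! ### The cone of positive products -/

lemma sharpProd_eq {m : ℕ} (v : Fin m → E n) :
    sharpProd v = (List.ofFn fun j => pairForm (v j) (v j)).prod := rfl

lemma sharpProd_cons {m : ℕ} (u : E n) (v : Fin m → E n) :
    sharpProd (Fin.cons u v : Fin (m + 1) → E n) = pairForm u u * sharpProd v := by
  simp [sharpProd_eq, List.ofFn_succ]

variable (n) in
/-- The convex cone of sums of products `α_1 ∧ α_1^# ∧ ⋯ ∧ α_m ∧ α_m^#`. -/
def sharpCone (m : ℕ) : AddSubmonoid (Form n) :=
  AddSubmonoid.closure (range (sharpProd : (Fin m → E n) → Form n))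

lemma pairForm_mul_mem_sharpCone {m : ℕ} (u : E n) {z : Form n} (hz : z ∈ sharpCone n m) :
    pairForm u u * z ∈ sharpCone n (m + 1) := by
  induction hz using AddSubmonoid.closure_induction with
  | mem x hx =>
    obtain ⟨v, rfl⟩ := hx
    exact AddSubmonoid.subset_closure ⟨Fin.cons u v, sharpProd_cons u v⟩
  | zero => simp
  | add x y _ _ hx hy => rw [mul_add]; exact add_mem hx hy

lemma sum_pairForm_pow_mem_sharpCone {ι : Type*} (s : Finset ι) (b : ι → E n) (m : ℕ) :
    (∑ i ∈ s, pairForm (b i) (b i)) ^ m ∈ sharpCone n m := by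
  induction m with
  | zero => exact AddSubmonoid.subset_closure ⟨Fin.elim0, by simp [sharpProd]⟩
  | succ m ih =>
    rw [pow_succ', Finset.sum_mul]
    exact sum_mem fun i _ => pairForm_mul_mem_sharpCone _ ih

lemma beta_pow_mem_sharpCone (m : ℕ) : beta n ^ m ∈ sharpCone n m :=
  sum_pairForm_pow_mem_sharpCone _ _ _

lemma pairForm_mul_beta_pow_mem_sharpCone (u : E n) (m : ℕ) :
    pairForm u u * beta n ^ m ∈ sharpCone n (m + 1) :=
  pairForm_mul_mem_sharpCone u (beta_pow_mem_sharpCone m)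

/-- The binomial formula stops after the linear term because `x² = 0`. For the same reason `x
(x+y)^m = x y^m`, so the linear term can be written with the full power of `x + y`, which will be
`β^m`. -/
lemma add_pow_of_sq_zero {R : Type*} [Ring R] {x y : R} (h : Commute x y) (hx : x * x = 0)
    (m : ℕ) : (x + y) ^ (m + 1) = y ^ (m + 1) + (m + 1) * (x * (x + y) ^ m) := by
  have key : ∀ k : ℕ, x * (x + y) ^ k = x * y ^ k := fun k => by
    induction k with
    | zero => simp
    | succ k ih =>
      have hc : Commute x ((x + y) ^ k) := ((Commute.refl x).add_right h).pow_right k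
      rw [pow_succ, ← mul_assoc, ih, mul_add, mul_assoc, ← (h.pow_right k).eq, ← mul_assoc, hx,
        pow_succ]
      simp [mul_assoc]
  rw [key]
  induction m with
  | zero => simp [add_comm]
  | succ m ih =>
    have hc : Commute x ((x + y) ^ (m + 1)) := ((Commute.refl x).add_right h).pow_right _
    rw [pow_succ' (x + y) (m + 1), add_mul, key, ih]
    have hmy : Commute y ((m : R) + 1) :=
      (Nat.cast_commute m y).symm.add_right (Commute.one_right y)
    have : y * (((m : R) + 1) * (x * y ^ m)) = ((m : R) + 1) * (x * y ^ (m + 1)) := by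
      rw [← mul_assoc, hmy.eq, mul_assoc, ← mul_assoc y x, ← h.eq, mul_assoc, ← pow_succ']
    rw [mul_add, this, ← pow_succ']
    push_cast
    noncomm_ring

/-- Extend `u` to an orthonormal basis and let `β'` be the part of `β` from the other basis vectors.
Since `u ∧ u^#` has square zero, the difference is exactly `β'^(m+1)`, a sum of positive products.
-/
lemma beta_pow_sub_mem_sharpCone {u : E n} (hu : ‖u‖ = 1) (m : ℕ) :
    beta n ^ (m + 1) - ((m : ℝ) + 1) • (pairForm u u * beta n ^ m) ∈ sharpCone n (m + 1) := by
  have hon : Orthonormal ℝ ((↑) : ({u} : Set (E n)) → E n) := by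
    refine ⟨fun i => ?_, fun i j hij => (hij (Subsingleton.elim i j)).elim⟩
    rw [mem_singleton_iff.1 i.2, hu]
  obtain ⟨s, b, hus, hb⟩ := hon.exists_orthonormalBasis_extension
  classical
  have hmem : u ∈ s := hus rfl
  have hbeta : beta n = pairForm u u +
      ∑ i ∈ Finset.univ.erase (⟨u, hmem⟩ : s), pairForm (i : E n) i := by
    rw [beta_eq_sum_orthonormalBasis b, hb]
    exact (Finset.add_sum_erase _ (fun i : s => pairForm (i : E n) i) (Finset.mem_univ _)).symm
  have h := add_pow_of_sq_zero (commute_pairForm u u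
    (∑ i ∈ Finset.univ.erase (⟨u, hmem⟩ : s), pairForm (i : E n) i)) (pairForm_mul_self u) m
  rw [← hbeta] at h
  rw [h, ← Nat.cast_succ, ← Nat.cast_succ, ← nsmul_eq_mul, Nat.cast_smul_eq_nsmul,
    add_sub_cancel_right]
  exact sum_pairForm_pow_mem_sharpCone _ _ _

namespace IsWeaklyPositiveForm

variable {m : ℕ} {α : Form n →ₗ[ℝ] ℝ}

lemma nonneg_of_mem (hα : IsWeaklyPositiveForm m α) {z : Form n} (hz : z ∈ sharpCone n m) :
    0 ≤ α z := by
  induction hz using AddSubmonoid.closure_induction with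
  | mem x hx => obtain ⟨v, rfl⟩ := hx; exact hα v
  | zero => simp
  | add x y _ _ hx hy => rw [map_add]; exact add_nonneg hx hy

lemma pairForm_nonneg (hα : IsWeaklyPositiveForm (m + 1) α) (u : E n) :
    0 ≤ α (pairForm u u * beta n ^ m) :=
  hα.nonneg_of_mem (pairForm_mul_beta_pow_mem_sharpCone u m)

/-- The unit-vector case rescaled by homogeneity. The factor `m + 1` is the dimension of the
current, and it makes `|x-a|` to that power the right comparison function. -/
lemma pairForm_le (hα : IsWeaklyPositiveForm (m + 1) α) (u : E n) :
    ((m : ℝ) + 1) * α (pairForm u u * beta n ^ m) ≤ ‖u‖ ^ 2 * α (beta n ^ (m + 1)) := by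
  rcases eq_or_ne u 0 with rfl | hu
  · simp [pairForm]
  have hn : ‖u‖ ≠ 0 := norm_ne_zero_iff.2 hu
  have h1 : ‖‖u‖⁻¹ • u‖ = 1 := by rw [norm_smul, norm_inv, norm_norm, inv_mul_cancel₀ hn]
  have h2 := hα.nonneg_of_mem (beta_pow_sub_mem_sharpCone h1 m)
  have h3 : pairForm u u = ‖u‖ ^ 2 • pairForm (‖u‖⁻¹ • u) (‖u‖⁻¹ • u) := by
    rw [pairForm_smul_left, pairForm_smul_right, smul_smul, smul_smul]
    field_simp
    simp
  rw [map_sub, map_smul, smul_eq_mul, sub_nonneg] at h2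
  rw [h3, smul_mul_assoc, map_smul, smul_eq_mul, mul_left_comm]
  exact mul_le_mul_of_nonneg_left h2 (by positivity)

end IsWeaklyPositiveForm

/-! ### The span of the positive products and the bidegree -/

variable (n) in
/-- The span of the products `α_1 ∧ α_1^# ∧ ⋯ ∧ α_m ∧ α_m^#`. -/
def sharpSpan (m : ℕ) : Submodule ℝ (Form n) :=
  Submodule.span ℝ (range (sharpProd : (Fin m → E n) → Form n))

lemma sharpCone_le_sharpSpan {m : ℕ} {z : Form n} (hz : z ∈ sharpCone n m) :
    z ∈ sharpSpan n m :=
  (AddSubmonoid.closure_le (S := (sharpSpan n m).toAddSubmonoid)).2 Submodule.subset_span hz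

/-- Polarization of the quadratic map `u ↦ u ∧ u^#`. -/
lemma pairForm_add_swap_mem_sharpSpan (u v : E n) (m : ℕ) :
    (pairForm u v + pairForm v u) * beta n ^ m ∈ sharpSpan n (m + 1) := by
  have h : (pairForm u v + pairForm v u) * beta n ^ m =
      pairForm (u + v) (u + v) * beta n ^ m - pairForm u u * beta n ^ m -
        pairForm v v * beta n ^ m := by
    simp only [pairForm_add_left, pairForm_add_right]
    noncomm_ring
  have hm := fun u : E n => sharpCone_le_sharpSpan (pairForm_mul_beta_pow_mem_sharpCone u m)
  rw [h]
  exact sub_mem (sub_mem (hm _) (hm _)) (hm _)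

lemma formX_mul_bidegree {p q : ℕ} (u : E n) {z : Form n} (hz : z ∈ bidegree n p q) :
    formX u * z ∈ bidegree n (p + 1) q := by
  have h := Submodule.mul_mem_mul (LinearMap.mem_range_self (formX (n := n)) u) hz
  rwa [bidegree, ← mul_assoc, ← pow_succ'] at h

lemma commute_range_formXi_formX :
    Commute (LinearMap.range (formXi (n := n))) (LinearMap.range (formX (n := n))) := by
  refine le_antisymm (Submodule.mul_le.2 ?_) (Submodule.mul_le.2 ?_)
  · rintro _ ⟨u, rfl⟩ _ ⟨v, rfl⟩
    rw [formXi_mul_formX]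
    exact neg_mem (Submodule.mul_mem_mul ⟨v, rfl⟩ ⟨u, rfl⟩)
  · rintro _ ⟨u, rfl⟩ _ ⟨v, rfl⟩
    rw [← neg_neg (formX u * formXi v), ← formXi_mul_formX]
    exact neg_mem (Submodule.mul_mem_mul ⟨v, rfl⟩ ⟨u, rfl⟩)

lemma formXi_mul_bidegree {p q : ℕ} (u : E n) {z : Form n} (hz : z ∈ bidegree n p q) :
    formXi u * z ∈ bidegree n p (q + 1) := by
  have h := Submodule.mul_mem_mul (LinearMap.mem_range_self (formXi (n := n)) u) hz
  rwa [bidegree, ← mul_assoc, (commute_range_formXi_formX.pow_right p).eq, mul_assoc,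
    ← pow_succ'] at h

lemma formXi_mem_bidegree (u : E n) : formXi u ∈ bidegree n 0 1 := by
  simp [bidegree]

lemma pairForm_mul_bidegree {p q : ℕ} (u v : E n) {z : Form n} (hz : z ∈ bidegree n p q) :
    pairForm u v * z ∈ bidegree n (p + 1) (q + 1) := by
  rw [pairForm, mul_assoc]
  exact formX_mul_bidegree u (formXi_mul_bidegree v hz)

lemma one_mem_bidegree : (1 : Form n) ∈ bidegree n 0 0 := by
  simp [bidegree, Submodule.one_le.1 le_rfl]

lemma beta_pow_mem_bidegree (m : ℕ) : beta n ^ m ∈ bidegree n m m := by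
  induction m with
  | zero => simpa using one_mem_bidegree
  | succ m ih =>
    rw [pow_succ', beta_eq_sum_pairForm, Finset.sum_mul]
    exact sum_mem fun j _ => pairForm_mul_bidegree _ _ ih

lemma sharpProd_mem_bidegree {m : ℕ} (v : Fin m → E n) : sharpProd v ∈ bidegree n m m := by
  induction m with
  | zero => simpa [sharpProd] using one_mem_bidegree
  | succ m ih =>
    rw [← Fin.cons_self_tail v, sharpProd_cons]
    exact pairForm_mul_bidegree _ _ (ih _)

/-! ### The involution `J` -/

lemma formJ_formX (u : E n) : formJ (formX u) = formXi u := by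
  simp [formJ, formX, formXi, covecJ]

lemma formJ_formXi (u : E n) : formJ (formXi u) = -formX u := by
  rw [← map_neg]
  simp [formJ, formX, formXi, covecJ]

lemma formJ_pairForm (u v : E n) : formJ (pairForm u v) = pairForm v u := by
  rw [pairForm, map_mul, formJ_formX, formJ_formXi, mul_neg, formXi_mul_formX, neg_neg, pairForm]

lemma formJ_beta : formJ (beta n) = beta n := by
  rw [beta_eq_sum_pairForm, map_sum]
  simp_rw [formJ_pairForm]

/-! ### The form of bidegree `(1, 1)` of an endomorphism -/

/-- The form `∑ k, dx_k ∧ (L e_k)^#` of an endomorphism `L`. -/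
def endForm : (E n →L[ℝ] E n) →ₗ[ℝ] Form n where
  toFun L := ∑ k, pairForm (e k) (L (e k))
  map_add' L M := by simp [pairForm_add_right, Finset.sum_add_distrib]
  map_smul' c L := by simp [pairForm_smul_right, Finset.smul_sum]

lemma endForm_apply (L : E n →L[ℝ] E n) : endForm L = ∑ k, pairForm (e k) (L (e k)) := rfl

lemma endForm_id : endForm (ContinuousLinearMap.id ℝ (E n)) = beta n := rfl

lemma sum_inner_smul_e (u : E n) : ∑ k, inner ℝ u (e k) • (e k : E n) = u := by
  conv_rhs => rw [← (EuclideanSpace.basisFun (Fin n) ℝ).sum_repr' u]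
  simp [e, EuclideanSpace.inner_single_left, EuclideanSpace.inner_single_right]

lemma endForm_smulRight (u v : E n) :
    endForm ((innerSL ℝ u).smulRight v) = pairForm u v := by
  conv_rhs => rw [← sum_inner_smul_e u, pairForm_sum_left]
  simp [endForm_apply, pairForm_smul_left, pairForm_smul_right]

/-- Self-adjointness allows `L` to be moved to the other slot of each pair. Averaging the two
expressions leaves symmetrized pairs, which polarization handles. It is applied to Hessians. -/
lemma endForm_mul_beta_pow_mem_sharpSpan {L : E n →L[ℝ] E n}
    (hL : ∀ u v, inner ℝ (L u) v = inner ℝ u (L v)) (m : ℕ) :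
    endForm L * beta n ^ m ∈ sharpSpan n (m + 1) := by
  have h : (2 : ℝ) • endForm L = ∑ k, (pairForm (e k) (L (e k)) + pairForm (L (e k)) (e k)) := by
    have h2 : endForm L = ∑ k, pairForm (L (e k)) (e k) := by
      have : ∀ k, L (e k) = ∑ j, inner ℝ (L (e k)) (e j) • (e j : E n) :=
        fun k => (sum_inner_smul_e _).symm
      rw [endForm_apply, Finset.sum_congr rfl fun k _ => by rw [this k, pairForm_sum_right],
        Finset.sum_congr rfl fun k (_ : k ∈ Finset.univ) => show pairForm (L (e k)) (e k) = _ by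
          conv_lhs => rw [this k, pairForm_sum_left],
        Finset.sum_comm]
      refine Finset.sum_congr rfl fun j _ => Finset.sum_congr rfl fun k _ => ?_
      rw [pairForm_smul_left, pairForm_smul_right, hL, real_inner_comm]
    rw [Finset.sum_add_distrib, ← h2, ← endForm_apply, two_smul]
  have h' : endForm L * beta n ^ m = (2⁻¹ : ℝ) •
      ∑ k, (pairForm (e k) (L (e k)) + pairForm (L (e k)) (e k)) * beta n ^ m := by
    rw [← Finset.sum_mul, ← h, smul_mul_assoc, smul_smul]
    norm_num
  rw [h']
  exact Submodule.smul_mem _ _ (sum_mem fun k _ => pairForm_add_swap_mem_sharpSpan _ _ _)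

/-! ### Test functions and test forms -/

instance instFiniteDimensionalForm : FiniteDimensional ℝ (Form n) :=
  (coeffs n).symm.finiteDimensional

variable {D : Opens (E n)}

lemma exists_testFunction_eq_one {K U : Set (E n)} (hK : IsCompact K) (hU : IsOpen U)
    (hKU : K ⊆ U) (hUD : U ⊆ D) : ∃ η : 𝓓(D, ℝ), (∀ x, 0 ≤ η x ∧ η x ≤ 1) ∧
      (∀ x ∈ K, η x = 1) ∧ tsupport η ⊆ U := by
  obtain ⟨K', hK', hKK', hK'U⟩ := exists_compact_between hK hU hKU
  obtain ⟨f, hf1, hf0, hf⟩ := exists_contMDiffMap_one_nhds_of_subset_interior (n := (⊤ : ℕ∞))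
    (modelWithCornersSelf ℝ (E n)) hK.isClosed hKK'
  have hsub : tsupport f ⊆ K' := closure_minimal
    (fun x hx => by by_contra h; exact hx (hf0 x h)) hK'.isClosed
  exact ⟨⟨f, f.contMDiff.contDiff, hK'.of_isClosed_subset (isClosed_tsupport _) hsub,
    hsub.trans (hK'U.trans hUD)⟩, hf, fun x hx => hf1.self_of_nhdsSet x hx, hsub.trans hK'U⟩

section

variable {F : Type*} [NormedAddCommGroup F] [NormedSpace ℝ F]

/-- The product of a test function and a smooth function. -/
def mulTest (χ : 𝓓(D, ℝ)) (g : E n → F) (hg : ContDiff ℝ ∞ g) : 𝓓(D, F) :=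
  ⟨fun x => χ x • g x, χ.contDiff.smul hg, χ.hasCompactSupport.smul_right,
    (tsupport_smul_subset_left (fun x => χ x) g).trans χ.tsupport_subset⟩

lemma mulTest_apply (χ : 𝓓(D, ℝ)) (g : E n → F) (hg : ContDiff ℝ ∞ g) (x : E n) :
    mulTest χ g hg x = χ x • g x := rfl

end

/-- The test form `f z` with a constant form `z`. -/
def smulForm (f : 𝓓(D, ℝ)) (z : Form n) : 𝓓(D, Form n) :=
  mulTest f (fun _ => z) contDiff_const

lemma smulForm_apply (f : 𝓓(D, ℝ)) (z : Form n) (x : E n) : smulForm f z x = f x • z := rfl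

variable (n) in
lemma exists_bidegreeProj (p q : ℕ) : ∃ π : Form n →ₗ[ℝ] bidegree n p q,
    π ∘ₗ (bidegree n p q).subtype = LinearMap.id :=
  (bidegree n p q).subtype.exists_leftInverse_of_injective (Submodule.ker_subtype _)

variable (n) in
/-- A projection of the forms to the forms of bidegree `(p, q)`. -/
def bidegreeProj (p q : ℕ) : Form n →L[ℝ] bidegree n p q :=
  LinearMap.toContinuousLinearMap (exists_bidegreeProj n p q).choose

lemma bidegreeProj_coe {p q : ℕ} (z : bidegree n p q) : bidegreeProj n p q z = z :=
  LinearMap.congr_fun (exists_bidegreeProj n p q).choose_spec z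

lemma coe_bidegreeProj {p q : ℕ} {z : Form n} (hz : z ∈ bidegree n p q) :
    (bidegreeProj n p q z : Form n) = z :=
  congrArg Subtype.val (bidegreeProj_coe ⟨z, hz⟩)

/-- The test form of bidegree `(p, q)` given by the projection of a form-valued test function. -/
def toTestForm (p q : ℕ) (ψ : 𝓓(D, Form n)) : TestForm D p q :=
  TestFunction.postcompCLM (bidegreeProj n p q) ψ

lemma coe_toTestForm {p q : ℕ} {ψ : 𝓓(D, Form n)} {x : E n} (h : ψ x ∈ bidegree n p q) :
    (toTestForm p q ψ x : Form n) = ψ x :=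
  coe_bidegreeProj h

namespace Supercurrent

variable {m k : ℕ}

/-- A supercurrent as a functional on the test functions with values in forms. -/
def onForms (T : Supercurrent D m m) : 𝓓(D, Form n) →ₗ[ℝ] ℝ :=
  (T ∘L TestFunction.postcompCLM (bidegreeProj n m m)).toLinearMap

lemma onForms_apply (T : Supercurrent D m m) (ψ : 𝓓(D, Form n)) :
    T.onForms ψ = T (toTestForm m m ψ) := rfl

lemma onForms_eq (T : Supercurrent D m m) {φ : TestForm D m m} {ψ : 𝓓(D, Form n)}
    (h : ∀ x, (φ x : Form n) = ψ x) : T.onForms ψ = T φ := by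
  rw [onForms_apply]
  congr 1
  ext1 x
  refine Subtype.ext ?_
  rw [h x, coe_toTestForm]
  rw [← h x]
  exact (φ x).2

/-- The functional `f ↦ T . f z`. -/
def onFunctions (T : Supercurrent D m m) (z : Form n) : 𝓓(D, ℝ) →ₗ[ℝ] ℝ where
  toFun f := T.onForms (smulForm f z)
  map_add' f g := by
    rw [← map_add]
    exact congrArg _ (TestFunction.ext fun x => add_smul _ _ _)
  map_smul' c f := by
    rw [← map_smul]
    exact congrArg _ (TestFunction.ext fun x => smul_assoc c (f x) z)

lemma onFunctions_apply (T : Supercurrent D m m) (z : Form n) (f : 𝓓(D, ℝ)) :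
    T.onFunctions z f = T.onForms (smulForm f z) := rfl

/-- The functional `z ↦ T . f z`. -/
def onConstants (T : Supercurrent D m m) (f : 𝓓(D, ℝ)) : Form n →ₗ[ℝ] ℝ where
  toFun z := T.onForms (smulForm f z)
  map_add' f g := by
    rw [← map_add]
    exact congrArg _ (TestFunction.ext fun x => smul_add _ _ _)
  map_smul' c f := by
    rw [← map_smul]
    exact congrArg _ (TestFunction.ext fun x => smul_comm _ _ _)

end Supercurrent

/-! ### Positivity, symmetry and closedness tested on smooth forms -/

lemma sharpProd_smul {m : ℕ} (c : Fin m → ℝ) (v : Fin m → E n) :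
    sharpProd (fun j => c j • v j) = (∏ j, c j) ^ 2 • sharpProd v := by
  induction m with
  | zero => simp [sharpProd]
  | succ m ih =>
    have h1 : (fun j => c j • v j) =
        Fin.cons (c 0 • v 0) (fun j => Fin.tail c j • Fin.tail v j) := by
      ext1 j
      cases j using Fin.cases <;> simp [Fin.tail]
    rw [h1, sharpProd_cons, ih, ← Fin.cons_self_tail v, sharpProd_cons, pairForm_smul_left,
      pairForm_smul_right, Fin.prod_univ_succ, smul_smul, smul_mul_smul_comm]
    congr 1
    simp [Fin.tail]
    ring

namespace Supercurrent

variable {k : ℕ} {T : Supercurrent D (k + 1) (k + 1)}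

/-- The coefficient `f` should be absorbed as the square of a factor of one covector field. Since
`√f` need not be smooth where `f` vanishes, `√(f + ε)` is used, cut off by `η`, and `ε → 0` at the
end. -/
lemma IsPositive.onForms_smulForm_sharpProd_nonneg (hT : T.IsPositive) {f : 𝓓(D, ℝ)}
    (hf : ∀ x, 0 ≤ f x) (v : Fin (k + 1) → E n) : 0 ≤ T.onForms (smulForm f (sharpProd v)) := by
  obtain ⟨η, -, hη, -⟩ := exists_testFunction_eq_one f.hasCompactSupport.isCompact D.isOpen
    f.tsupport_subset le_rfl
  have hfη : ∀ x, f x * η x = f x := fun x => by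
    by_cases hx : x ∈ tsupport f
    · rw [hη x hx, mul_one]
    · rw [image_eq_zero_of_notMem_tsupport hx, zero_mul]
  -- All `k + 1` covector fields carry the cutoff `η`, and each occurs twice in the product. The
  -- error term therefore has the coefficient `η^(2k+2) = η · η^(2k+1)`.
  have hηp : ContDiff ℝ ∞ fun x => η x ^ (2 * k + 1) := η.contDiff.pow _
  set ζ : 𝓓(D, ℝ) := mulTest η (fun x => η x ^ (2 * k + 1)) hηp with hζ
  have key : ∀ ε : ℝ, 0 < ε → 0 ≤ T.onForms (smulForm f (sharpProd v)) +
      ε * T.onForms (smulForm ζ (sharpProd v)) := fun ε hε => by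
    have hs : ContDiff ℝ ∞ fun x => √(f x + ε) :=
      (f.contDiff.add contDiff_const).sqrt fun x => (add_pos_of_nonneg_of_pos (hf x) hε).ne'
    let α : Fin (k + 1) → 𝓓(D, E n) := Fin.cons
      (mulTest η (fun x => √(f x + ε) • v 0) (hs.smul contDiff_const))
      (fun j => mulTest η (fun _ => v j.succ) contDiff_const)
    have hα : ∀ x, (sharpProd fun j => α j x) =
        (smulForm f (sharpProd v) + ε • smulForm ζ (sharpProd v) : 𝓓(D, Form n)) x := fun x => by
      have h1 : (fun j => α j x) = fun j : Fin (k + 1) =>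
          (Fin.cons (η x * √(f x + ε)) (fun _ => η x) : Fin (k + 1) → ℝ) j • v j := by
        ext1 j
        cases j using Fin.cases <;> simp [α, mulTest_apply, smul_smul]
      have h2 : (η x * √(f x + ε) * η x ^ k) ^ 2 = f x + ε * (η x * η x ^ (2 * k + 1)) := by
        have hp : ∀ l : ℕ, f x * η x ^ l = f x := fun l => by
          induction l with
          | zero => simp
          | succ l ih => rw [pow_succ, ← mul_assoc, ih, hfη]
        rw [mul_pow, mul_pow, Real.sq_sqrt (add_pos_of_nonneg_of_pos (hf x) hε).le]
        conv_rhs => rw [← hp (2 + k * 2)]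
        ring
      rw [h1, sharpProd_smul, Fin.prod_univ_succ]
      simp only [Fin.cons_zero, Fin.cons_succ, Finset.prod_const, Finset.card_univ,
        Fintype.card_fin]
      rw [h2, add_smul, mul_smul]
      rfl
    have hmem : ∀ x, (smulForm f (sharpProd v) + ε • smulForm ζ (sharpProd v) : 𝓓(D, Form n)) x ∈
        bidegree n (k + 1) (k + 1) := fun x => by
      rw [← hα]
      exact sharpProd_mem_bidegree _
    have h := hT α (toTestForm (k + 1) (k + 1)
      (smulForm f (sharpProd v) + ε • smulForm ζ (sharpProd v)))
      fun x => by rw [coe_toTestForm (hmem x), hα]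
    rwa [← onForms_apply, map_add, map_smul, smul_eq_mul] at h
  have hlim : Tendsto (fun ε : ℝ => T.onForms (smulForm f (sharpProd v)) +
      ε * T.onForms (smulForm ζ (sharpProd v))) (𝓝[>] 0)
      (𝓝 (T.onForms (smulForm f (sharpProd v)) +
        0 * T.onForms (smulForm ζ (sharpProd v)))) :=
    ((continuous_const.add (continuous_id.mul continuous_const)).tendsto 0).mono_left
      nhdsWithin_le_nhds
  rw [zero_mul, add_zero] at hlim
  exact ge_of_tendsto hlim (eventually_nhdsWithin_of_forall fun ε hε => key ε hε)

/-- The smeared current is itself a weakly positive constant form, so a pointwise hypothesis about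
all such forms can be applied to `T`. -/
lemma IsPositive.isWeaklyPositiveForm_onConstants (hT : T.IsPositive) {f : 𝓓(D, ℝ)}
    (hf : ∀ x, 0 ≤ f x) : IsWeaklyPositiveForm (k + 1) (T.onConstants f) :=
  fun v => hT.onForms_smulForm_sharpProd_nonneg hf v

end Supercurrent

/-- The elements of the span of a set of vectors of a finite-dimensional space are, linearly,
combinations of finitely many elements of the set. -/
lemma exists_linear_coordinates {V : Type*} [AddCommGroup V] [Module ℝ V] [FiniteDimensional ℝ V]
    {ι : Type*} (w : ι → V) : ∃ (t : Finset V) (c : V → V →ₗ[ℝ] ℝ), (∀ b ∈ t, b ∈ range w) ∧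
      ∀ z ∈ Submodule.span ℝ (range w), z = ∑ b ∈ t, c b z • b := by
  classical
  obtain ⟨b, hbw, hspan, hli⟩ := exists_linearIndependent ℝ (range w)
  have hfin : b.Finite := hli.setFinite
  replace hli : LinearIndepOn ℝ id b := hli
  let B := Module.Basis.extend hli
  have hB : ∀ i : V, i ∈ b → ∃ j, B j = i := fun i hi =>
    ⟨⟨i, hli.subset_extend (subset_univ _) hi⟩, Module.Basis.extend_apply_self hli _⟩
  refine ⟨hfin.toFinset, fun i => if h : i ∈ b then B.coord (hB i h).choose else 0,
    fun i hi => hbw (hfin.mem_toFinset.1 hi), fun z hz => ?_⟩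
  rw [← hspan] at hz
  induction hz using Submodule.span_induction with
  | mem z hz =>
    dsimp only
    rw [Finset.sum_eq_single z]
    · have aux : ∀ j, B j = z → B.coord j z = 1 := by rintro j rfl; simp
      rw [dif_pos hz, aux _ (hB z hz).choose_spec, one_smul]
    · intro i hi hiz
      have hib := hfin.mem_toFinset.1 hi
      rw [dif_pos hib]
      have hne : (hB z hz).choose ≠ (hB i hib).choose := fun h => hiz (by
        rw [← (hB z hz).choose_spec, ← (hB i hib).choose_spec, h])
      have : B.coord (hB i hib).choose z = 0 := by
        conv_lhs => rw [← (hB z hz).choose_spec]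
        simp [hne]
      rw [this, zero_smul]
    · exact fun h => (h (hfin.mem_toFinset.2 hz)).elim
  | zero => simp
  | add x y _ _ hx hy =>
    conv_lhs => rw [hx, hy]
    simp [add_smul, Finset.sum_add_distrib]
  | smul a x _ hx =>
    conv_lhs => rw [hx]
    simp [mul_smul, Finset.smul_sum]

/-- A partition of unity on a compact set by test functions, subordinate to an open covering. -/
lemma exists_testFunction_partition {K : Set (E n)} (hK : IsCompact K) {η : 𝓓(D, ℝ)}
    (hη : ∀ x, 0 ≤ η x) (hη1 : ∀ x ∈ K, η x = 1)
    (U : E n → Set (E n)) (hU : ∀ x, IsOpen (U x)) (hxU : ∀ x, x ∈ U x) :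
    ∃ (s : Finset (E n)) (χ : s → 𝓓(D, ℝ)), (∀ i x, 0 ≤ χ i x) ∧
      (∀ i x, χ i x ≠ 0 → x ∈ U i) ∧ (∀ x ∈ K, ∑ i, χ i x = 1) ∧ (∀ x, ∑ i, χ i x ≤ η x) := by
  obtain ⟨s, hs⟩ := hK.elim_finite_subcover U hU fun x _ => mem_iUnion.2 ⟨x, hxU x⟩
  obtain ⟨f, hf⟩ := SmoothPartitionOfUnity.exists_isSubordinate
    (modelWithCornersSelf ℝ (E n)) hK.isClosed (fun i : s => U i) (fun i => hU i)
    (hs.trans (iUnion₂_subset fun i hi => subset_iUnion_of_subset ⟨i, hi⟩ le_rfl))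
  have hsum : ∀ x, ∑ i, f i x = ∑ᶠ i, f i x := fun x => (finsum_eq_sum_of_fintype _).symm
  refine ⟨s, fun i => mulTest η (f i) (f i).contMDiff.contDiff,
    fun i x => mul_nonneg (hη x) (f.nonneg i x), fun i x hx => ?_, fun x hx => ?_, fun x => ?_⟩
  · refine hf i (subset_tsupport _ fun h => hx ?_)
    rw [mulTest_apply, h, smul_zero]
  · simp_rw [mulTest_apply, hη1 x hx, one_smul]
    rw [hsum, f.sum_eq_one hx]
  · simp_rw [mulTest_apply, smul_eq_mul, ← Finset.mul_sum, hsum]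
    exact mul_le_of_le_one_right (hη x) (f.sum_le_one x)

lemma sum_testFunction_apply {F ι : Type*} [NormedAddCommGroup F] [NormedSpace ℝ F]
    (s : Finset ι) (f : ι → 𝓓(D, F)) (x : E n) : (∑ i ∈ s, f i) x = ∑ i ∈ s, f i x := by
  classical
  induction s using Finset.induction_on with
  | empty => rfl
  | insert a s ha ih => rw [Finset.sum_insert ha, Finset.sum_insert ha, ← ih]; rfl

namespace Supercurrent

variable {k : ℕ} {T : Supercurrent D (k + 1) (k + 1)}

lemma IsPositive.onFunctions_nonneg (hT : T.IsPositive) {z : Form n}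
    (hz : z ∈ sharpCone n (k + 1)) {f : 𝓓(D, ℝ)} (hf : ∀ x, 0 ≤ f x) :
    0 ≤ T.onFunctions z f :=
  (hT.isWeaklyPositiveForm_onConstants hf).nonneg_of_mem hz

lemma IsPositive.onFunctions_mono (hT : T.IsPositive) {z : Form n}
    (hz : z ∈ sharpCone n (k + 1)) {f g : 𝓓(D, ℝ)} (hfg : ∀ x, f x ≤ g x) :
    T.onFunctions z f ≤ T.onFunctions z g := by
  rw [← sub_nonneg, ← map_sub]
  exact hT.onFunctions_nonneg hz fun x => sub_nonneg.2 (hfg x)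

/-- A positive supercurrent is nonnegative on the test forms which are, at each point, in the span
of the positive products and nonnegative against the weakly positive constant forms. -/
theorem IsPositive.onForms_nonneg (hT : T.IsPositive) {ψ : 𝓓(D, Form n)}
    (hψ : ∀ x, ψ x ∈ sharpSpan n (k + 1))
    (hpos : ∀ x (α : Form n →ₗ[ℝ] ℝ), IsWeaklyPositiveForm (k + 1) α → 0 ≤ α (ψ x)) :
    0 ≤ T.onForms ψ := by
  obtain ⟨t, c, ht, hc⟩ :=
    exists_linear_coordinates (sharpProd : (Fin (k + 1) → E n) → Form n)
  have htc : ∀ b ∈ t, b ∈ sharpCone n (k + 1) := fun b hb => AddSubmonoid.subset_closure (ht b hb)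
  obtain ⟨η, hη, hη1, -⟩ := exists_testFunction_eq_one ψ.hasCompactSupport.isCompact D.isOpen
    ψ.tsupport_subset le_rfl
  set C := ∑ b ∈ t, T.onFunctions b η
  let f : Form n → 𝓓(D, ℝ) := fun b =>
    TestFunction.postcompCLM (LinearMap.toContinuousLinearMap (c b)) ψ
  have hf : ∀ b x, f b x = c b (ψ x) := fun _ _ => rfl
  suffices h : ∀ δ : ℝ, 0 < δ → -(δ * C) ≤ T.onForms ψ by
    have hlim : Tendsto (fun δ : ℝ => -(δ * C)) (𝓝[>] 0) (𝓝 (-(0 * C))) :=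
      ((continuous_id.mul continuous_const).neg.tendsto 0).mono_left nhdsWithin_le_nhds
    rw [zero_mul, neg_zero] at hlim
    exact le_of_tendsto hlim (eventually_nhdsWithin_of_forall fun δ hδ => h δ hδ)
  intro δ hδ
  -- On the piece around `i`, every coefficient of `ψ` exceeds its value at `i` minus `δ`. A
  -- one-sided bound suffices, as the basis elements in `t` are positive products.
  obtain ⟨s, χ, hχ0, hχU, hχ1, hχη⟩ := exists_testFunction_partition
    ψ.hasCompactSupport.isCompact (fun x => (hη x).1) hη1
    (fun x => ⋂ b ∈ t, {y | f b x - δ < f b y})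
    (fun x => isOpen_biInter_finset fun b _ => isOpen_lt continuous_const (f b).continuous)
    (fun x => mem_iInter₂.2 fun b _ => sub_lt_self _ hδ)
  have hdecomp : T.onForms ψ =
      ∑ i, ∑ b ∈ t, T.onFunctions b (mulTest (χ i) (f b) (f b).contDiff) := by
    simp_rw [onFunctions_apply, ← map_sum]
    congr 1
    ext1 x
    simp_rw [sum_testFunction_apply, smulForm_apply, mulTest_apply, smul_assoc, ← Finset.smul_sum]
    rw [← Finset.sum_smul]
    by_cases hx : x ∈ tsupport ψ
    · rw [hχ1 x hx, one_smul]
      exact hc _ (hψ x)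
    · have h0 := image_eq_zero_of_notMem_tsupport hx
      simp [hf, h0]
  have hterm : ∀ (i : s), ∀ b ∈ t, (f b i - δ) * T.onFunctions b (χ i) ≤
      T.onFunctions b (mulTest (χ i) (f b) (f b).contDiff) := fun i b hb => by
    rw [← smul_eq_mul, ← map_smul]
    refine hT.onFunctions_mono (htc b hb) fun x => ?_
    change (f b i - δ) * χ i x ≤ χ i x * f b x
    rw [mul_comm]
    rcases eq_or_ne (χ i x) 0 with h | h
    · simp [h]
    · exact mul_le_mul_of_nonneg_left (mem_iInter₂.1 (hχU i x h) b hb).le (hχ0 i x)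
  -- Freezing `ψ` at `i` leaves a constant form, and `z ↦ T . χ i z` is weakly positive. Hence
  -- `hpos` at the point `i` applies.
  have hconst : ∀ i : s, 0 ≤ ∑ b ∈ t, f b i * T.onFunctions b (χ i) := fun i => by
    have h := hpos i _ (hT.isWeaklyPositiveForm_onConstants (hχ0 i))
    rw [hc _ (hψ i), map_sum] at h
    simp only [map_smul, smul_eq_mul] at h
    exact h
  have hC : ∑ i : s, ∑ b ∈ t, T.onFunctions b (χ i) ≤ C := by
    rw [Finset.sum_comm]
    refine Finset.sum_le_sum fun b hb => ?_
    rw [← map_sum]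
    refine hT.onFunctions_mono (htc b hb) fun x => ?_
    rw [sum_testFunction_apply]
    exact hχη x
  calc -(δ * C) ≤ ∑ i : s, (∑ b ∈ t, f b i * T.onFunctions b (χ i)) -
        δ * ∑ i : s, ∑ b ∈ t, T.onFunctions b (χ i) := by
        have h1 := Finset.sum_nonneg fun i (_ : i ∈ Finset.univ) => hconst i
        have h2 := mul_le_mul_of_nonneg_left hC hδ.le
        linarith
    _ = ∑ i : s, ∑ b ∈ t, (f b i - δ) * T.onFunctions b (χ i) := by
        simp_rw [sub_mul, Finset.sum_sub_distrib, Finset.mul_sum]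
    _ ≤ T.onForms ψ := by
        rw [hdecomp]
        exact Finset.sum_le_sum fun i _ => Finset.sum_le_sum fun b hb => hterm i b hb

/-- A symmetric supercurrent vanishes on the antisymmetric test forms. -/
lemma IsSymmetric.onForms_eq_zero {m : ℕ} {T : Supercurrent D m m} (hT : T.IsSymmetric)
    {ψ : 𝓓(D, Form n)} (hψ : ∀ x, ψ x ∈ bidegree n m m) (hJ : ∀ x, formJ (ψ x) = -ψ x) :
    T.onForms ψ = 0 := by
  have h := hT (toTestForm m m ψ) (toTestForm m m (-ψ)) fun x => by
    have hx : (-ψ) x ∈ bidegree n m m := neg_mem (hψ x)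
    rw [coe_toTestForm (hψ x), coe_toTestForm hx, hJ]
    rfl
  rw [← onForms_apply, ← onForms_apply, map_neg] at h
  linarith

lemma extD_formXi_comp {X : E n → E n} (hX : Differentiable ℝ X) (x : E n) :
    extD (fun y => formXi (X y)) x = endForm (fderiv ℝ X x) := by
  have h : HasFDerivAt (fun y => formXi (X y))
      ((LinearMap.toContinuousLinearMap (formXi (n := n))).comp (fderiv ℝ X x)) x :=
    (LinearMap.toContinuousLinearMap (formXi (n := n))).hasFDerivAt.comp x (hX x).hasFDerivAt
  rw [extD, h.fderiv]
  rfl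

/-- The vector field `X` encodes the `(0,1)`-form `X^#`, whose exterior derivative is the form of
the Jacobian of `X`. The order of the factors is immaterial since `β` is central. -/
lemma IsClosedBeta.onForms_eq_zero (hT : T.IsClosedBeta) (X : 𝓓(D, E n)) {ψ : 𝓓(D, Form n)}
    (hψ : ∀ x, ψ x = endForm (fderiv ℝ X x) * beta n ^ k) : T.onForms ψ = 0 := by
  refine hT (toTestForm 0 1 (TestFunction.postcompCLM
    (LinearMap.toContinuousLinearMap (formXi (n := n))) X)) (toTestForm _ _ ψ) fun x => ?_
  have hx : ψ x ∈ bidegree n (k + 1) (k + 1) := by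
    rw [hψ, endForm_apply, Finset.sum_mul]
    exact sum_mem fun j _ => pairForm_mul_bidegree _ _ (beta_pow_mem_bidegree k)
  have h1 : (fun y => ((toTestForm 0 1 (TestFunction.postcompCLM
      (LinearMap.toContinuousLinearMap (formXi (n := n))) X) y : bidegree n 0 1) : Form n)) =
      fun y => formXi (X y) := by
    ext1 y
    exact coe_toTestForm (formXi_mem_bidegree (X y))
  rw [coe_toTestForm hx, hψ, h1, extD_formXi_comp (X.contDiff.differentiable (by simp)),
    Nat.add_sub_cancel, ((commute_beta _).pow_left k).eq]

end Supercurrent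

/-- `d d^# u` in terms of the derivative of the gradient. -/
lemma ddSharp_eq_endForm {u : E n → ℝ} {G : E n → E n}
    (hu : ∀ x, HasFDerivAt u (innerSL ℝ (G x)) x) (hG : Differentiable ℝ G) (x : E n) :
    ddSharp u x = endForm (fderiv ℝ G x) := by
  have h : extDSharp (fun x => algebraMap ℝ (Form n) (u x)) = fun y => formXi (G y) := by
    ext1 y
    have h1 : HasFDerivAt (fun x => algebraMap ℝ (Form n) (u x))
        ((LinearMap.toContinuousLinearMap (Algebra.linearMap ℝ (Form n))).comp
          (innerSL ℝ (G y))) y :=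
      (LinearMap.toContinuousLinearMap (Algebra.linearMap ℝ (Form n))).hasFDerivAt.comp y (hu y)
    rw [extDSharp, h1.fderiv]
    conv_rhs => rw [← sum_inner_smul_e (G y), map_sum]
    refine Finset.sum_congr rfl fun k _ => ?_
    rw [map_smul, Algebra.smul_def]
    exact (Algebra.commutes (R := ℝ) (A := Form n) _ _).symm
  rw [ddSharp, h, Supercurrent.extD_formXi_comp hG]

/-! ### The mass of a positive supercurrent -/

namespace Supercurrent

section

variable {m : ℕ} {T : Supercurrent D m m}

/-- The functional `χ ↦ T . (χ β^m / m!)`. -/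
def trace (T : Supercurrent D m m) : 𝓓(D, ℝ) →ₗ[ℝ] ℝ :=
  T.onFunctions ((m.factorial : ℝ)⁻¹ • beta n ^ m)

lemma le_mass (χ : 𝓓(D, ℝ)) {U : Set (E n)} (h01 : ∀ x, 0 ≤ χ x ∧ χ x ≤ 1)
    (hU : tsupport χ ⊆ U) : ENNReal.ofReal (T.trace χ) ≤ T.mass U := by
  have h : ∀ x, (toTestForm m m (smulForm χ ((m.factorial : ℝ)⁻¹ • beta n ^ m)) x : Form n) =
      χ x • ((m.factorial : ℝ)⁻¹ • beta n ^ m) := fun x =>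
    coe_toTestForm (Submodule.smul_mem _ _ (Submodule.smul_mem _ _ (beta_pow_mem_bidegree m)))
  rw [mass]
  refine le_iSup_of_le χ (le_iSup_of_le _ (le_iSup_of_le h01 (le_iSup_of_le hU
    (le_iSup_of_le h ?_))))
  rw [trace, onFunctions_apply, onForms_apply]

lemma mass_le {U : Set (E n)} {C : ℝ≥0∞} (h : ∀ χ : 𝓓(D, ℝ), (∀ x, 0 ≤ χ x ∧ χ x ≤ 1) →
    tsupport χ ⊆ U → ENNReal.ofReal (T.trace χ) ≤ C) : T.mass U ≤ C := by
  refine iSup_le fun χ => iSup_le fun φ => iSup_le fun h01 => iSup_le fun hU => iSup_le fun hφ => ?_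
  refine le_trans (le_of_eq ?_) (h χ h01 hU)
  rw [trace, onFunctions_apply, T.onForms_eq (φ := φ) fun x => hφ x]

end

variable {k : ℕ} {T : Supercurrent D (k + 1) (k + 1)}

lemma IsPositive.trace_mono (hT : T.IsPositive) {f g : 𝓓(D, ℝ)} (hfg : ∀ x, f x ≤ g x) :
    T.trace f ≤ T.trace g := by
  have h := hT.onFunctions_mono (beta_pow_mem_sharpCone (k + 1)) hfg
  have h2 : ∀ f, T.trace f = ((k + 1).factorial : ℝ)⁻¹ * T.onFunctions (beta n ^ (k + 1)) f :=
    fun f => map_smul (T.onConstants f) _ _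
  rw [h2, h2]
  exact mul_le_mul_of_nonneg_left h (by positivity)

lemma IsPositive.mass_lt_top (hT : T.IsPositive) {K U : Set (E n)} (hK : IsCompact K)
    (hKD : K ⊆ D) (hU : U ⊆ K) : T.mass U < ⊤ := by
  obtain ⟨η, hη, hη1, -⟩ := exists_testFunction_eq_one hK D.isOpen hKD le_rfl
  refine (mass_le (C := ENNReal.ofReal (T.trace η)) fun χ h01 hχ => ?_).trans_lt
    ENNReal.ofReal_lt_top
  refine ENNReal.ofReal_le_ofReal (hT.trace_mono fun x => ?_)
  by_cases hx : x ∈ tsupport χ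
  · rw [hη1 x (hU (hχ hx))]
    exact (h01 x).2
  · rw [image_eq_zero_of_notMem_tsupport hx]
    exact (hη x).1

end Supercurrent

/-! ### Smooth auxiliary functions -/

/-- A smooth approximation of the positive part. -/
def softPos (u : ℝ) : ℝ := ∫ t in (0 : ℝ)..u, Real.smoothTransition t

lemma hasDerivAt_softPos (u : ℝ) : HasDerivAt softPos (Real.smoothTransition u) u :=
  intervalIntegral.integral_hasDerivAt_right
    (Real.smoothTransition.continuous.intervalIntegrable _ _)
    (Real.smoothTransition.continuous.stronglyMeasurableAtFilter _ _)
    Real.smoothTransition.continuousAt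

lemma contDiff_softPos : ContDiff ℝ ∞ softPos := by
  refine contDiff_infty_iff_deriv.2 ⟨fun u => (hasDerivAt_softPos u).differentiableAt, ?_⟩
  rw [show deriv softPos = Real.smoothTransition from funext fun u => (hasDerivAt_softPos u).deriv]
  exact Real.smoothTransition.contDiff

lemma softPos_of_nonpos {u : ℝ} (hu : u ≤ 0) : softPos u = 0 := by
  rw [softPos, intervalIntegral.integral_symm, neg_eq_zero,
    intervalIntegral.integral_congr (g := fun _ => 0), intervalIntegral.integral_zero]
  intro t ht
  rw [uIcc_of_le hu] at ht
  exact Real.smoothTransition.zero_of_nonpos ht.2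

lemma monotone_softPos : Monotone softPos :=
  monotone_of_deriv_nonneg (fun u => (hasDerivAt_softPos u).differentiableAt)
    fun u => by rw [(hasDerivAt_softPos u).deriv]; exact Real.smoothTransition.nonneg u

lemma softPos_nonneg (u : ℝ) : 0 ≤ softPos u := by
  rcases le_total u 0 with h | h
  · rw [softPos_of_nonpos h]
  · rw [← softPos_of_nonpos le_rfl]
    exact monotone_softPos h

/-- Beyond `1` the slope is one, so the gap to `u` stays constant. After rescaling, `δ * softPos (u
/ δ)` is at least the positive part of `u` minus `δ`. -/
lemma sub_one_le_softPos (u : ℝ) : u - 1 ≤ softPos u := by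
  rcases le_total u 1 with h | h
  · exact (sub_nonpos.2 h).trans (softPos_nonneg u)
  · have hm : MonotoneOn (fun u => softPos u - u) (Ici 1) := by
      have hd : ∀ t, HasDerivAt (fun u => softPos u - u) (Real.smoothTransition t - 1) t :=
        fun t => (hasDerivAt_softPos t).sub (hasDerivAt_id t)
      refine monotoneOn_of_deriv_nonneg (convex_Ici 1)
        (fun t _ => (hd t).continuousAt.continuousWithinAt)
        (fun t _ => (hd t).differentiableAt.differentiableWithinAt) fun t ht => ?_
      rw [interior_Ici] at ht
      rw [(hd t).deriv, Real.smoothTransition.one_of_one_le (le_of_lt ht), sub_self]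
    have h2 : softPos 1 - 1 ≤ softPos u - u := hm (mem_Ici.2 le_rfl) h h
    have h1 := softPos_nonneg 1
    linarith

/-- Smooth approximations `h` of `p ↦ max(2p, r²)^{m/2}`, with the logarithmic derivative
`m λ / (2p)`. -/
lemma exists_radial_profile (k : ℕ) {r₁ r : ℝ} (h0 : 0 < r₁) (hr : r₁ < r) :
    ∃ h h' l : ℝ → ℝ, ContDiff ℝ ∞ h ∧ ContDiff ℝ ∞ l ∧ (∀ p, HasDerivAt h (h' p) p) ∧
      (∀ p, 0 ≤ h' p) ∧ (∀ p, 0 < h p) ∧ (∀ ρ, 0 ≤ ρ → ρ ^ (k + 1) ≤ h (ρ ^ 2 / 2)) ∧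
      (∀ p, p ≤ r₁ ^ 2 / 2 → h p = r ^ (k + 1) ∧ l p = 0) ∧
      (∀ p, 0 ≤ p → 0 ≤ l p ∧ l p ≤ 1) ∧
      (∀ p, 2 * p * h' p = ((k : ℝ) + 1) * (l p * h p)) := by
  have hr0 : 0 < r := h0.trans hr
  -- With this width the loss of one in `sub_one_le_softPos` costs `2 d = r² - r₁²` in `Q`, exactly
  -- what its constant `r²` compensates. Thus `Q ≥ 2p`, while `Q = r²` for `p ≤ r₁²/2`. Then `h =
  -- Q^{m/2}` with `m = k + 1`, and `l = p Q'/Q`.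
  set d : ℝ := (r ^ 2 - r₁ ^ 2) / 2 with hd
  have hd0 : 0 < d := by
    have : r₁ ^ 2 < r ^ 2 := by gcongr
    rw [hd]; linarith
  set Q : ℝ → ℝ := fun p => r ^ 2 + 2 * (d * softPos ((p - r₁ ^ 2 / 2) / d)) with hQ
  set Q' : ℝ → ℝ := fun p => 2 * Real.smoothTransition ((p - r₁ ^ 2 / 2) / d) with hQ'
  have haff : ContDiff ℝ ∞ fun p : ℝ => (p - r₁ ^ 2 / 2) / d := by fun_prop
  have hQsm : ContDiff ℝ ∞ Q :=
    contDiff_const.add (contDiff_const.mul (contDiff_const.mul (contDiff_softPos.comp haff)))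
  have hQ'sm : ContDiff ℝ ∞ Q' :=
    contDiff_const.mul (Real.smoothTransition.contDiff.comp haff)
  have hQd : ∀ p, HasDerivAt Q (Q' p) p := fun p => by
    have h1 : HasDerivAt (fun p : ℝ => (p - r₁ ^ 2 / 2) / d) (1 / d) p :=
      ((hasDerivAt_id p).sub_const _).div_const d
    have h2 := (((hasDerivAt_softPos _).comp p h1).const_mul d).const_mul 2 |>.const_add (r ^ 2)
    refine h2.congr_deriv ?_
    simp only [hQ']
    field_simp
  have hQr : ∀ p, r ^ 2 ≤ Q p := fun p => by
    have := softPos_nonneg ((p - r₁ ^ 2 / 2) / d)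
    simp only [hQ]
    have : 0 ≤ d * softPos ((p - r₁ ^ 2 / 2) / d) := by positivity
    linarith
  have hQ0 : ∀ p, 0 < Q p := fun p => lt_of_lt_of_le (by positivity) (hQr p)
  have hQ2 : ∀ p, 2 * p ≤ Q p := fun p => by
    have h1 := mul_le_mul_of_nonneg_left (sub_one_le_softPos ((p - r₁ ^ 2 / 2) / d)) hd0.le
    rw [mul_sub, mul_div_cancel₀ _ hd0.ne'] at h1
    simp only [hQ]
    rw [hd] at h1 ⊢
    linarith
  have hQ'0 : ∀ p, 0 ≤ Q' p := fun p => mul_nonneg zero_le_two (Real.smoothTransition.nonneg _)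
  have hQ'2 : ∀ p, Q' p ≤ 2 := fun p => by
    have := Real.smoothTransition.le_one ((p - r₁ ^ 2 / 2) / d)
    simp only [hQ']; linarith
  have hs : ContDiff ℝ ∞ fun p => √(Q p) := hQsm.sqrt fun p => (hQ0 p).ne'
  have hs0 : ∀ p, 0 < √(Q p) := fun p => Real.sqrt_pos.2 (hQ0 p)
  refine ⟨fun p => √(Q p) ^ (k + 1), fun p => ((k : ℝ) + 1) * √(Q p) ^ (k + 1) * (Q' p / (2 * Q p)),
    fun p => p * Q' p / Q p, hs.pow _,
    (contDiff_id.mul hQ'sm).div hQsm fun p => (hQ0 p).ne', fun p => ?_, fun p => ?_, fun p => ?_,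
    fun ρ hρ => ?_, fun p hp => ?_, fun p hp => ⟨?_, ?_⟩, fun p => ?_⟩
  · have h1 := ((hQd p).sqrt (hQ0 p).ne').pow (k + 1)
    refine h1.congr_deriv ?_
    have h3 : Q p = √(Q p) * √(Q p) := (Real.mul_self_sqrt (hQ0 p).le).symm
    have h4 := (hs0 p).ne'
    rw [Nat.add_sub_cancel]
    push_cast
    rw [show Q' p / (2 * √(Q p)) = √(Q p) * (Q' p / (2 * Q p)) by
      rw [show Q' p / (2 * Q p) = Q' p / (2 * (√(Q p) * √(Q p))) by rw [← h3]]; field_simp]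
    ring
  · have := hQ'0 p; have := hQ0 p; positivity
  · exact pow_pos (hs0 p) _
  · refine pow_le_pow_left₀ hρ (Real.le_sqrt_of_sq_le ?_) _
    have := hQ2 (ρ ^ 2 / 2)
    linarith
  · have h1 : (p - r₁ ^ 2 / 2) / d ≤ 0 := div_nonpos_of_nonpos_of_nonneg (by linarith) hd0.le
    have h2 : Q p = r ^ 2 := by simp only [hQ]; rw [softPos_of_nonpos h1]; ring
    have h3 : Q' p = 0 := by
      simp only [hQ']; rw [Real.smoothTransition.zero_of_nonpos h1, mul_zero]
    simp only [h2, h3]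
    rw [Real.sqrt_sq hr0.le]
    simp
  · have := hQ'0 p; have := hQ0 p; positivity
  · rw [div_le_one (hQ0 p)]
    calc p * Q' p ≤ p * 2 := mul_le_mul_of_nonneg_left (hQ'2 p) hp
      _ ≤ Q p := by linarith [hQ2 p]
  · have := (hQ0 p).ne'
    field_simp

/-- Integrals of a smooth function over `[0, 1]` depend smoothly on parameters. -/
lemma contDiff_integral_zero_one {P : Type*} [NormedAddCommGroup P] [NormedSpace ℝ P]
    {f : P × ℝ → ℝ} (hf : ContDiff ℝ ∞ f) : ContDiff ℝ ∞ fun p => ∫ s in (0 : ℝ)..1, f (p, s) := by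
  obtain ⟨χ, hχ⟩ : ∃ χ : ContDiffBump (0 : ℝ), χ.rIn = 1 :=
    ⟨⟨1, 2, one_pos, one_lt_two⟩, rfl⟩
  have hχ1 : ∀ s ∈ Icc (0 : ℝ) 1, χ (-s) = 1 := fun s hs =>
    χ.one_of_mem_closedBall (by
      rw [hχ, mem_closedBall_zero_iff, norm_neg, Real.norm_of_nonneg hs.1]; exact hs.2)
  -- The integral is the convolution at `0` of the indicator of `(0, 1]` with `g p`. The bump `χ`
  -- only provides the compact support, being one where the indicator lives.
  let g : P → ℝ → ℝ := fun p s => χ s * f (p, -s)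
  have hg : ContDiff ℝ ∞ ↿g :=
    (χ.contDiff.comp contDiff_snd).mul (hf.comp (contDiff_fst.prodMk contDiff_snd.neg))
  have hconv := contDiffOn_convolution_right_with_param_comp (μ := volume) (n := ⊤)
    (ContinuousLinearMap.mul ℝ ℝ) (s := (univ : Set P)) (v := fun _ => (0 : ℝ))
    (f := (Ioc (0 : ℝ) 1).indicator fun _ => 1) (g := g) (k := tsupport χ)
    contDiffOn_const isOpen_univ χ.hasCompactSupport
    (fun p s _ hs => by simp [g, image_eq_zero_of_notMem_tsupport hs])
    ((integrable_indicator_iff measurableSet_Ioc).2 (by simp)).locallyIntegrable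
    hg.contDiffOn
  rw [contDiffOn_univ] at hconv
  convert hconv using 2 with p
  rw [intervalIntegral.integral_of_le zero_le_one, ← integral_indicator measurableSet_Ioc,
    convolution]
  refine integral_congr_ae (Eventually.of_forall fun s => ?_)
  by_cases hs : s ∈ Ioc (0 : ℝ) 1
  · simp [indicator_of_mem hs, g, hχ1 s (Ioc_subset_Icc_self hs)]
  · simp [indicator_of_notMem hs]

section

variable {F : ℝ × ℝ → ℝ} {M : ℝ}

/-- The affine substitution moves the variable endpoint into the integrand, so that smoothness in
both variables becomes a statement about a fixed interval. -/
lemma integral_eq_integral_zero_one (p v : ℝ) : ∫ t in p..M, F (t, v) =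
    ∫ s in (0 : ℝ)..1, (M - p) * F (p + (M - p) * s, v) := by
  have h := intervalIntegral.smul_integral_comp_add_mul (fun t => F (t, v)) (M - p) p
    (a := 0) (b := 1)
  rw [intervalIntegral.integral_const_mul, ← smul_eq_mul, h]
  simp

lemma contDiff_integral_upper (hF : ContDiff ℝ ∞ F) :
    ContDiff ℝ ∞ fun q : ℝ × ℝ => ∫ t in q.1..M, F (t, q.2) := by
  simp_rw [integral_eq_integral_zero_one]
  exact contDiff_integral_zero_one
    (f := fun z : (ℝ × ℝ) × ℝ => (M - z.1.1) * F (z.1.1 + (M - z.1.1) * z.2, z.1.2))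
    (by fun_prop)

/-- The derivative of `(p, v) ↦ ∫ t in p..M, F (t, v)` for `F` increasing in `v`. -/
lemma exists_hasFDerivAt_integral_upper (hF : ContDiff ℝ ∞ F)
    (hmono : ∀ t, Monotone fun v => F (t, v)) {p v : ℝ} (hp : p ≤ M) :
    ∃ c : ℝ, 0 ≤ c ∧ HasFDerivAt (fun q : ℝ × ℝ => ∫ t in q.1..M, F (t, q.2))
      (-F (p, v) • ContinuousLinearMap.fst ℝ ℝ ℝ + c • ContinuousLinearMap.snd ℝ ℝ ℝ) (p, v) := by
  have hd := ((contDiff_integral_upper (M := M) hF).differentiable (by simp) (p, v)).hasFDerivAt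
  set L := fderiv ℝ (fun q : ℝ × ℝ => ∫ t in q.1..M, F (t, q.2)) (p, v)
  have hcont : ∀ v, Continuous fun t => F (t, v) := fun v => hF.continuous.comp (by fun_prop)
  have h1 : L (1, 0) = -F (p, v) := by
    have hA : HasDerivAt (fun s => ∫ t in s..M, F (t, v)) (L (1, 0)) p :=
      hd.comp_hasDerivAt (f := fun s => (s, v)) p ((hasDerivAt_id p).prodMk (hasDerivAt_const p v))
    exact hA.unique (intervalIntegral.integral_hasDerivAt_left
      ((hcont v).intervalIntegrable _ _) ((hcont v).stronglyMeasurableAtFilter _ _)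
      (hcont v).continuousAt)
  have h2 : 0 ≤ L (0, 1) := by
    have hA : HasDerivAt (fun s => ∫ t in p..M, F (t, s)) (L (0, 1)) v :=
      hd.comp_hasDerivAt (f := fun s => (p, s)) v ((hasDerivAt_const v p).prodMk (hasDerivAt_id v))
    have hm : Monotone fun s => ∫ t in p..M, F (t, s) := fun s s' hs =>
      intervalIntegral.integral_mono_on hp ((hcont s).intervalIntegrable _ _)
        ((hcont s').intervalIntegrable _ _) fun t _ => hmono t hs
    rw [← hA.deriv]
    exact hm.deriv_nonneg
  refine ⟨L (0, 1), h2, hd.congr_fderiv ?_⟩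
  ext <;> simp [h1]

end

/-! ### Smooth functions cut off on a compact set -/

section

variable {D : Opens (E n)} {F : Type*} [NormedAddCommGroup F]

open Classical in
-- As `g` vanishes on `D \ K`, cutting off at `K` changes nothing on `D`, an open neighbourhood of
-- `K`. No jump occurs at the boundary of `K`.
lemma indicator_eventuallyEq {K : Set (E n)} (hK : IsCompact K) (hKD : K ⊆ D) {g : E n → F}
    (h0 : ∀ x ∈ D, x ∉ K → g x = 0) (x : E n) : K.indicator g =ᶠ[𝓝 x] if x ∈ K then g else 0 := by
  split_ifs with h
  · filter_upwards [D.isOpen.mem_nhds (hKD h)] with y hy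
    by_cases hyK : y ∈ K
    · rw [indicator_of_mem hyK]
    · rw [indicator_of_notMem hyK, h0 y hy hyK]
  · filter_upwards [hK.isClosed.isOpen_compl.mem_nhds h] with y hy
    exact indicator_of_notMem hy _

variable [NormedSpace ℝ F]

/-- A smooth function on `D` that vanishes outside a compact set `K ⊆ D`. -/
def indicatorTest {K : Set (E n)} (hK : IsCompact K) (hKD : K ⊆ D) {g : E n → F}
    (hg : ContDiff ℝ ∞ g) (h0 : ∀ x ∈ D, x ∉ K → g x = 0) : 𝓓(D, F) where
  toFun := K.indicator g
  contDiff' := contDiff_iff_contDiffAt.2 fun x => by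
    refine ContDiffAt.congr_of_eventuallyEq ?_ (indicator_eventuallyEq hK hKD h0 x)
    split_ifs
    · exact hg.contDiffAt
    · exact contDiffAt_const
  hasCompactSupport' := hK.of_isClosed_subset (isClosed_tsupport _)
    (closure_minimal support_indicator_subset hK.isClosed)
  tsupport_subset' := (closure_minimal support_indicator_subset hK.isClosed).trans hKD

variable {K : Set (E n)} (hK : IsCompact K) (hKD : K ⊆ D) {g : E n → F}
    (hg : ContDiff ℝ ∞ g) (h0 : ∀ x ∈ D, x ∉ K → g x = 0)

lemma indicatorTest_of_mem {x : E n} (hx : x ∈ K) : indicatorTest hK hKD hg h0 x = g x :=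
  indicator_of_mem hx g

lemma indicatorTest_of_notMem {x : E n} (hx : x ∉ K) : indicatorTest hK hKD hg h0 x = 0 :=
  indicator_of_notMem hx g

lemma tsupport_indicatorTest : tsupport (indicatorTest hK hKD hg h0) ⊆ K :=
  closure_minimal support_indicator_subset hK.isClosed

lemma fderiv_indicatorTest_of_mem {x : E n} (hx : x ∈ K) :
    fderiv ℝ (indicatorTest hK hKD hg h0) x = fderiv ℝ g x := by
  have h := indicator_eventuallyEq hK hKD h0 x
  rw [if_pos hx] at h
  exact h.fderiv_eq

lemma fderiv_indicatorTest_of_notMem {x : E n} (hx : x ∉ K) :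
    fderiv ℝ (indicatorTest hK hKD hg h0) x = 0 := by
  have h := indicator_eventuallyEq hK hKD h0 x
  rw [if_neg hx] at h
  exact h.fderiv_eq.trans (fderiv_const_apply 0)

end

/-! ### The vector field -/

lemma contDiff_gradient {v : E n → ℝ} (hv : ContDiff ℝ ∞ v) : ContDiff ℝ ∞ (gradient v) :=
  (InnerProductSpace.toDual ℝ (E n)).symm.toContinuousLinearEquiv.contDiff.comp
    (hv.fderiv_right (m := ∞) (by simp))

lemma hasFDerivAt_gradient {v : E n → ℝ} (hv : ContDiff ℝ ∞ v) (x : E n) :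
    HasFDerivAt v (innerSL ℝ (gradient v x)) x :=
  ((hv.differentiable (by simp)) x).hasGradientAt.hasFDerivAt

lemma inner_fderiv_gradient {v : E n → ℝ} (hv : ContDiff ℝ ∞ v) (x u w : E n) :
    inner ℝ (fderiv ℝ (gradient v) x u) w = fderiv ℝ (fderiv ℝ v) x u w := by
  have hG := ((contDiff_gradient hv).differentiable (by simp) x).hasFDerivAt
  have h1 : HasFDerivAt (fun y => innerSL ℝ (gradient v y))
      ((innerSL ℝ).comp (fderiv ℝ (gradient v) x)) x := (innerSL ℝ).hasFDerivAt.comp x hG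
  have h2 : (fun y => innerSL ℝ (gradient v y)) = fderiv ℝ v :=
    funext fun y => (hasFDerivAt_gradient hv y).fderiv.symm
  rw [h2] at h1
  rw [h1.fderiv]
  rfl

lemma inner_fderiv_gradient_comm {v : E n → ℝ} (hv : ContDiff ℝ ∞ v) (x u w : E n) :
    inner ℝ (fderiv ℝ (gradient v) x u) w = inner ℝ u (fderiv ℝ (gradient v) x w) := by
  have hs : IsSymmSndFDerivAt ℝ v x := hv.contDiffAt.isSymmSndFDerivAt (by
    rw [minSmoothness_of_isRCLikeNormedField]; exact WithTop.coe_le_coe.2 le_top)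
  rw [inner_fderiv_gradient hv, hs.eq, ← inner_fderiv_gradient hv, real_inner_comm]

lemma endForm_fderiv_field {A B : E n → ℝ} {G : E n → E n} {a x u w : E n}
    (hA : HasFDerivAt A (innerSL ℝ u) x) (hB : HasFDerivAt B (innerSL ℝ w) x)
    (hG : DifferentiableAt ℝ G x) :
    endForm (fderiv ℝ (fun x => A x • (x - a) + B x • G x) x) =
      A x • beta n + pairForm u (x - a) + (B x • endForm (fderiv ℝ G x) + pairForm w (G x)) := by
  have h := (hA.smul ((hasFDerivAt_id x).sub_const a)).add (hB.smul hG.hasFDerivAt)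
  have h2 : fderiv ℝ (fun x => A x • (x - a) + B x • G x) x =
      (A x • ContinuousLinearMap.id ℝ (E n) + (innerSL ℝ u).smulRight (x - a)) +
      (B x • fderiv ℝ G x + (innerSL ℝ w).smulRight (G x)) := h.fderiv
  rw [h2, map_add, map_add, map_add, map_smul, map_smul, endForm_smulRight, endForm_smulRight,
    endForm_id]

/-- The linear map `L ↦ endForm L ∧ β^k`. -/
def endFormBeta (k : ℕ) : (E n →L[ℝ] E n) →L[ℝ] Form n :=
  LinearMap.toContinuousLinearMap (LinearMap.mulRight ℝ (beta n ^ k) ∘ₗ endForm)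

lemma endFormBeta_apply (k : ℕ) (L : E n →L[ℝ] E n) :
    endFormBeta k L = endForm L * beta n ^ k := rfl

lemma endFormBeta_wedge (k : ℕ) (u w : E n) :
    endFormBeta k ((innerSL ℝ u).smulRight w - (innerSL ℝ w).smulRight u) =
      (pairForm u w - pairForm w u) * beta n ^ k := by
  rw [endFormBeta_apply, map_sub, endForm_smulRight, endForm_smulRight]

lemma endFormBeta_mem_bidegree (k : ℕ) (L : E n →L[ℝ] E n) :
    endFormBeta k L ∈ bidegree n (k + 1) (k + 1) := by
  rw [endFormBeta_apply, endForm_apply, Finset.sum_mul]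
  exact sum_mem fun j _ => pairForm_mul_bidegree _ _ (beta_pow_mem_bidegree k)

/-! ### The integral inequality obtained from the vector field -/

namespace Supercurrent

variable {D : Opens (E n)} {k : ℕ} {T : Supercurrent D (k + 1) (k + 1)}

set_option maxHeartbeats 1000000 in
-- With `H` the smoothed `max(|x-a|, r)^m`, `g` the smoothed `(v-H)₊` and `g'` the smoothed
-- indicator of `v > H`, the weights are `Ξ = l g'` and `Θ = (1-l) g/H` on `K`. The difference `(Ξ -
-- Θ) β^m` is written as a multiple of `d(X^#) ∧ β^{m-1}`, an antisymmetric form and a form of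
-- nonnegative type. The function `l`, zero near `a`, is what separates the ball from its exterior.
lemma IsMinimal.trace_le (hT : T.IsMinimal) {v : E n → ℝ} (hv : ContDiff ℝ ∞ v)
    (hD : Bornology.IsBounded (D : Set (E n))) {a : E n} {K : Set (E n)} (hK : IsCompact K)
    (hKD : K ⊆ D) (hvK : ∀ x ∈ D, ‖x - a‖ ^ (k + 1) < v x → x ∈ K)
    (hpos : ∀ x ∈ K, ∀ α : Form n →ₗ[ℝ] ℝ, IsWeaklyPositiveForm (k + 1) α →
      0 ≤ α (ddSharp v x * beta n ^ k))
    {r₁ r δ : ℝ} (h0 : 0 < r₁) (hr : r₁ < r) (hδ : 0 < δ) :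
    ∃ Θ Ξ : 𝓓(D, ℝ), T.trace Θ ≤ T.trace Ξ ∧ tsupport Ξ ⊆ K ∧ (∀ x, 0 ≤ Ξ x ∧ Ξ x ≤ 1) ∧
      (∀ x, 0 ≤ Θ x) ∧ (∀ x, ‖x - a‖ ≤ r₁ → Ξ x = 0) ∧
      ∀ x ∈ D, ‖x - a‖ ≤ r₁ → Θ x = δ * softPos ((v x - r ^ (k + 1)) / δ) / r ^ (k + 1) := by
  have hr0 : 0 < r := h0.trans hr
  obtain ⟨h, h', l, hh, hl, hh', hh'0, hhpos, hhρ, hhr, hl01, hhl⟩ := exists_radial_profile k h0 hr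
  have hk0 : (0 : ℝ) < (k : ℝ) + 1 := by positivity
  have hmono : Monotone h := monotone_of_deriv_nonneg (fun p => (hh' p).differentiableAt)
    fun p => by rw [(hh' p).deriv]; exact hh'0 p
  -- the functions of `x`
  set p : E n → ℝ := fun x => ‖x - a‖ ^ 2 / 2 with hp
  have hp0 : ∀ x, 0 ≤ p x := fun x => by positivity
  have hpsm : ContDiff ℝ ∞ p := ((contDiff_id.sub contDiff_const).norm_sq ℝ).div_const _
  have hpd : ∀ x, HasFDerivAt p (innerSL ℝ (x - a)) x := fun x => by
    have h1 := (((hasFDerivAt_id x).sub_const a).norm_sq).mul_const (2⁻¹ : ℝ)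
    have h2 : p = fun x => ‖id x - a‖ ^ 2 * 2⁻¹ := by ext; simp [hp, div_eq_mul_inv]
    rw [h2]
    refine h1.congr_fderiv ?_
    ext w
    simp
  obtain ⟨M, hM⟩ : ∃ M, ∀ x ∈ D, p x ≤ M := by
    obtain ⟨R, hR⟩ := hD.subset_closedBall a
    refine ⟨R ^ 2 / 2, fun x hx => ?_⟩
    have h1 : ‖x - a‖ ≤ R := mem_closedBall_iff_norm.1 (hR hx)
    simp only [hp]
    gcongr
  set H : E n → ℝ := fun x => h (p x) with hH
  have hHsm : ContDiff ℝ ∞ H := hh.comp hpsm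
  have hH0 : ∀ x, 0 < H x := fun x => hhpos _
  have hHK : ∀ x ∈ D, x ∉ K → v x ≤ H x := fun x hx hxK =>
    (not_lt.1 fun hlt => hxK (hvK x hx hlt)).trans (hhρ _ (norm_nonneg _))
  set G : E n → E n := gradient v with hG
  have hGsm : ContDiff ℝ ∞ G := contDiff_gradient hv
  set s : E n → ℝ := fun x => (v x - H x) / δ with hs
  have hssm : ContDiff ℝ ∞ s := (hv.sub hHsm).div_const _
  have hs0 : ∀ x ∈ D, x ∉ K → s x ≤ 0 := fun x hx hxK =>
    div_nonpos_of_nonpos_of_nonneg (sub_nonpos.2 (hHK x hx hxK)) hδ.le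
  set g : E n → ℝ := fun x => δ * softPos (s x) with hg
  set g' : E n → ℝ := fun x => Real.smoothTransition (s x) with hg'
  have hgsm : ContDiff ℝ ∞ g := contDiff_const.mul (contDiff_softPos.comp hssm)
  have hg'sm : ContDiff ℝ ∞ g' := Real.smoothTransition.contDiff.comp hssm
  have hg0 : ∀ x ∈ D, x ∉ K → g x = 0 := fun x hx hxK => by
    simp only [hg, softPos_of_nonpos (hs0 x hx hxK), mul_zero]
  have hg'0 : ∀ x ∈ D, x ∉ K → g' x = 0 := fun x hx hxK =>
    Real.smoothTransition.zero_of_nonpos (hs0 x hx hxK)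
  have hgnn : ∀ x, 0 ≤ g x := fun x => mul_nonneg hδ.le (softPos_nonneg _)
  have hg'nn : ∀ x, 0 ≤ g' x := fun x => Real.smoothTransition.nonneg _
  set κ : ℝ → ℝ := fun t => (((k : ℝ) + 1) * h t)⁻¹ with hκ
  have hκsm : ContDiff ℝ ∞ κ :=
    (contDiff_const.mul hh).inv fun t => (mul_pos hk0 (hhpos t)).ne'
  have hκ0 : ∀ t, 0 < κ t := fun t => inv_pos.2 (mul_pos hk0 (hhpos t))
  have hκd : ∀ t, HasDerivAt κ (-(κ t * h' t / h t)) t := fun t => by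
    refine (((hh' t).const_mul ((k : ℝ) + 1)).inv (mul_pos hk0 (hhpos t)).ne').congr_deriv ?_
    have := (hhpos t).ne'
    simp only [hκ]
    field_simp
  -- In `∇A` the coefficient of `x - a` is nonnegative and that of `∇v` is `-κ g'`. The latter makes
  -- the mixed term that `B` has to balance.
  set A : E n → ℝ := fun x => -(κ (p x) * g x) with hA
  have hAsm : ContDiff ℝ ∞ A := ((hκsm.comp hpsm).mul hgsm).neg
  have hAd : ∀ x, HasFDerivAt A (innerSL ℝ ((κ (p x) * h' (p x) * (g' x + g x / H x)) • (x - a) -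
      (κ (p x) * g' x) • G x)) x := fun x => by
    have h1 : HasFDerivAt (fun x => κ (p x)) (-(κ (p x) * h' (p x) / h (p x)) •
      innerSL ℝ (x - a)) x := (hκd (p x)).comp_hasFDerivAt x (hpd x)
    have h2 : HasFDerivAt H (h' (p x) • innerSL ℝ (x - a)) x :=
      (hh' (p x)).comp_hasFDerivAt x (hpd x)
    have h3 : HasFDerivAt s (δ⁻¹ • (innerSL ℝ (G x) - h' (p x) • innerSL ℝ (x - a))) x := by
      have := ((hasFDerivAt_gradient hv x).sub h2).const_mul δ⁻¹
      refine this.congr_of_eventuallyEq (Eventually.of_forall fun y => ?_)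
      simp [hs, div_eq_inv_mul]
    have h4 : HasFDerivAt g (δ • (g' x •
        (δ⁻¹ • (innerSL ℝ (G x) - h' (p x) • innerSL ℝ (x - a))))) x :=
      ((hasDerivAt_softPos (s x)).comp_hasFDerivAt x h3).const_mul δ
    refine (h1.mul h4).neg.congr_fderiv ?_
    ext w
    have := (hH0 x).ne'
    have hHx : h (p x) = H x := rfl
    simp [hHx]
    field_simp
    ring
  -- `B` integrates `F` from `p x` up to a bound `M` for `p` on `D`. Differentiating the endpoint
  -- gives `∇B` the coefficient `κ g'` along `x - a`, the negative of the one in `∇A` along `∇v`.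
  -- Monotonicity of `F` in `v` makes the other coefficient, along `∇v`, nonpositive. Outside `K`
  -- the integrand vanishes, since `h(t) ≥ h(p x) ≥ v x`.
  set F : ℝ × ℝ → ℝ := fun q => Real.smoothTransition ((q.2 - h q.1) / δ) * κ q.1 with hF
  have hFsm : ContDiff ℝ ∞ F := by
    have : ContDiff ℝ ∞ fun q : ℝ × ℝ => (q.2 - h q.1) / δ :=
      (contDiff_snd.sub (hh.comp contDiff_fst)).div_const _
    exact (Real.smoothTransition.contDiff.comp this).mul (hκsm.comp contDiff_fst)
  have hFmono : ∀ t, Monotone fun u => F (t, u) := fun t u u' huu =>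
    mul_le_mul_of_nonneg_right (Real.smoothTransition.monotone (by dsimp only; gcongr)) (hκ0 t).le
  set B : E n → ℝ := fun x => -∫ t in p x..M, F (t, v x) with hB
  have hBsm : ContDiff ℝ ∞ B :=
    ((contDiff_integral_upper (M := M) hFsm).comp (hpsm.prodMk hv)).neg
  have hBd : ∀ x ∈ D, ∃ c : ℝ, 0 ≤ c ∧
      HasFDerivAt B (innerSL ℝ ((κ (p x) * g' x) • (x - a) - c • G x)) x := fun x hx => by
    obtain ⟨c, hc, hd⟩ := exists_hasFDerivAt_integral_upper hFsm hFmono (v := v x) (hM x hx)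
    refine ⟨c, hc, ?_⟩
    have h1 : HasFDerivAt (fun x => (p x, v x)) ((innerSL ℝ (x - a)).prod (innerSL ℝ (G x))) x :=
      (hpd x).prodMk (hasFDerivAt_gradient hv x)
    refine (hd.comp x h1).neg.congr_fderiv ?_
    ext w
    have hFx : F (p x, v x) = g' x * κ (p x) := rfl
    simp [hFx]
    ring
  have hB0 : ∀ x ∈ D, B x ≤ 0 := fun x hx => neg_nonpos.2
    (intervalIntegral.integral_nonneg (hM x hx) fun t _ =>
      mul_nonneg (Real.smoothTransition.nonneg _) (hκ0 t).le)
  have hBK : ∀ x ∈ D, x ∉ K → B x = 0 := fun x hx hxK => by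
    simp only [hB, neg_eq_zero]
    rw [intervalIntegral.integral_congr (g := fun _ => 0), intervalIntegral.integral_zero]
    intro t ht
    rw [uIcc_of_le (hM x hx)] at ht
    have : (v x - h t) / δ ≤ 0 := div_nonpos_of_nonpos_of_nonneg
      (sub_nonpos.2 ((hHK x hx hxK).trans (hmono ht.1))) hδ.le
    simp only [hF, Real.smoothTransition.zero_of_nonpos this, zero_mul]
  -- the test functions
  let X : 𝓓(D, E n) := indicatorTest hK hKD (g := fun x => A x • (x - a) + B x • G x)
    ((hAsm.smul (contDiff_id.sub contDiff_const)).add (hBsm.smul hGsm)) fun x hx hxK => by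
      simp [hA, hg0 x hx hxK, hBK x hx hxK]
  let ψX : 𝓓(D, Form n) := TestFunction.postcompCLM (endFormBeta k)
    (TestFunction.fderivCLM ℝ ⊤ ⊤ X : 𝓓(D, E n →L[ℝ] E n))
  have hψX : ∀ x, ψX x = endForm (fderiv ℝ X x) * beta n ^ k := fun x => by
    change endFormBeta k ((TestFunction.fderivCLM ℝ ⊤ ⊤ X : 𝓓(D, E n →L[ℝ] E n)) x) = _
    rw [TestFunction.fderivCLM_apply_of_le _ (by simp), endFormBeta_apply]
  -- The mixed terms of `d(X^#) ∧ β^k`. They change sign under `J`, so the symmetric current does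
  -- not see them.
  let C : E n → Form n := fun x => (κ (p x) * g' x) • endFormBeta k
    ((innerSL ℝ (x - a)).smulRight (G x) - (innerSL ℝ (G x)).smulRight (x - a))
  have hCsm : ContDiff ℝ ∞ C := by
    have h1 : ContDiff ℝ ∞ fun x : E n => x - a := contDiff_id.sub contDiff_const
    exact ((hκsm.comp hpsm).mul hg'sm).smul ((endFormBeta k).contDiff.comp
      ((((innerSL ℝ).contDiff.comp h1).smulRight hGsm).sub
        (((innerSL ℝ).contDiff.comp hGsm).smulRight h1)))
  let ψC : 𝓓(D, Form n) := indicatorTest hK hKD hCsm fun x hx hxK => by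
    simp [C, hg'0 x hx hxK]
  have hψC : T.onForms ψC = 0 := by
    refine hT.symmetric.onForms_eq_zero (fun x => ?_) fun x => ?_
    · by_cases hx : x ∈ K
      · rw [indicatorTest_of_mem hK hKD _ _ hx]
        exact Submodule.smul_mem _ _ (endFormBeta_mem_bidegree _ _)
      · rw [indicatorTest_of_notMem hK hKD _ _ hx]
        exact zero_mem _
    · by_cases hx : x ∈ K
      · rw [indicatorTest_of_mem hK hKD _ _ hx]
        simp only [C, endFormBeta_wedge]
        rw [map_smul, map_mul, map_pow, map_sub, formJ_pairForm, formJ_pairForm, formJ_beta,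
          ← smul_neg, ← neg_mul, neg_sub]
      · rw [indicatorTest_of_notMem hK hKD _ _ hx]
        simp
  let Ξ : 𝓓(D, ℝ) := indicatorTest hK hKD (g := fun x => l (p x) * g' x)
    ((hl.comp hpsm).mul hg'sm) fun x hx hxK => by simp [hg'0 x hx hxK]
  let Θ : 𝓓(D, ℝ) := indicatorTest hK hKD (g := fun x => (1 - l (p x)) * g x / H x)
    (((contDiff_const.sub (hl.comp hpsm)).mul hgsm).div hHsm fun x => (hH0 x).ne')
    fun x hx hxK => by simp [hg0 x hx hxK]
  have hΞ : ∀ x ∈ K, Ξ x = l (p x) * g' x := fun x hx => indicatorTest_of_mem hK hKD _ _ hx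
  have hΞ' : ∀ x, x ∉ K → Ξ x = 0 := fun x hx => indicatorTest_of_notMem hK hKD _ _ hx
  have hΘ : ∀ x ∈ K, Θ x = (1 - l (p x)) * g x / H x := fun x hx =>
    indicatorTest_of_mem hK hKD _ _ hx
  have hΘ' : ∀ x, x ∉ K → Θ x = 0 := fun x hx => indicatorTest_of_notMem hK hKD _ _ hx
  have hp1 : ∀ x, ‖x - a‖ ≤ r₁ → p x ≤ r₁ ^ 2 / 2 := fun x hx => by
    simp only [hp]
    gcongr
  refine ⟨Θ, Ξ, ?_, tsupport_indicatorTest hK hKD _ _, fun x => ?_, fun x => ?_, fun x hx => ?_,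
    fun x hxD hx => ?_⟩
  · let ψ : 𝓓(D, Form n) := smulForm (Ξ - Θ) (beta n ^ (k + 1)) - ((k : ℝ) + 1) • ψX +
      ((k : ℝ) + 1) • ψC
    -- The term `A β` of `d(X^#)` contributes `(g/H) β^(k+1)`, and `Ξ - Θ + g/H = l (g' + g/H)`. The
    -- first two terms below thus share the nonnegative factor `g' + g/H`.
    have hval : ∀ x ∈ K, ∃ c : ℝ, 0 ≤ c ∧ ψ x =
        (l (p x) * (g' x + g x / H x)) • beta n ^ (k + 1) -
        ((h' (p x) / H x) * (g' x + g x / H x)) • (pairForm (x - a) (x - a) * beta n ^ k) +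
        (((k : ℝ) + 1) * -B x) • (endForm (fderiv ℝ G x) * beta n ^ k) +
        c • (pairForm (G x) (G x) * beta n ^ k) := fun x hx => by
      obtain ⟨c, hc, hBx⟩ := hBd x (hKD hx)
      refine ⟨((k : ℝ) + 1) * c, by positivity, ?_⟩
      have e1 : ψ x = (Ξ x - Θ x) • beta n ^ (k + 1) - ((k : ℝ) + 1) • ψX x +
        ((k : ℝ) + 1) • ψC x := rfl
      have e2 : ψC x = (κ (p x) * g' x) •
          ((pairForm (x - a) (G x) - pairForm (G x) (x - a)) * beta n ^ k) := by
        rw [indicatorTest_of_mem hK hKD _ _ hx]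
        simp only [C, endFormBeta_wedge]
      have e3 : κ (p x) = ((k : ℝ) + 1)⁻¹ * (H x)⁻¹ := by simp only [hκ, mul_inv, hH]
      have e4 : A x = -(κ (p x) * g x) := rfl
      rw [e1, e2, hΞ x hx, hΘ x hx, hψX, fderiv_indicatorTest_of_mem hK hKD _ _ hx,
        endForm_fderiv_field (hAd x) hBx ((hGsm.differentiable (by simp)) x), e4, e3]
      have hHx := (hH0 x).ne'
      generalize x - a = y
      simp only [pairForm_sub_left, pairForm_smul_left, add_mul, sub_mul, smul_mul_assoc, ← pow_succ', smul_add, smul_sub,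
        smul_smul]
      match_scalars <;> field_simp <;> ring
    have hψ0 : ∀ x, x ∉ K → ψ x = 0 := fun x hx => by
      have e1 : ψ x = (Ξ x - Θ x) • beta n ^ (k + 1) - ((k : ℝ) + 1) • ψX x +
        ((k : ℝ) + 1) • ψC x := rfl
      rw [e1, hΞ' x hx, hΘ' x hx, hψX, fderiv_indicatorTest_of_notMem hK hKD _ _ hx,
        indicatorTest_of_notMem hK hKD _ _ hx]
      simp
    have hsm := fun u : E n => sharpCone_le_sharpSpan (pairForm_mul_beta_pow_mem_sharpCone u k)
    have hψnn : 0 ≤ T.onForms ψ := by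
      refine hT.positive.onForms_nonneg (fun x => ?_) fun x α hα => ?_
      · by_cases hx : x ∈ K
        · obtain ⟨c, -, hψ⟩ := hval x hx
          rw [hψ]
          refine add_mem (add_mem (sub_mem ?_ ?_) ?_) ?_ <;> refine Submodule.smul_mem _ _ ?_
          · exact sharpCone_le_sharpSpan (beta_pow_mem_sharpCone _)
          · exact hsm _
          · exact endForm_mul_beta_pow_mem_sharpSpan (inner_fderiv_gradient_comm hv x) k
          · exact hsm _
        · rw [hψ0 x hx]
          exact zero_mem _
      · by_cases hx : x ∈ K
        · obtain ⟨c, hc, hψ⟩ := hval x hx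
          rw [hψ]
          simp only [map_add, map_sub, map_smul, smul_eq_mul]
          have h1 := hpos x hx α hα
          rw [ddSharp_eq_endForm (hasFDerivAt_gradient hv) (hGsm.differentiable (by simp))] at h1
          have h2 := hα.pairForm_nonneg (G x)
          have h3 := hα.pairForm_le (x - a)
          have h4 := hB0 x (hKD hx)
          have h5 : 2 * p x * h' (p x) = ((k : ℝ) + 1) * (l (p x) * H x) := hhl (p x)
          have h6 : 2 * p x = ‖x - a‖ ^ 2 := by simp only [hp]; ring
          have hHx := hH0 x
          -- The sharp inequality for `u = x - a` meets the profile identity `2p h' = m l H`. The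
          -- weight `l` is defined so that these match.
          have h7 : h' (p x) / H x * α (pairForm (x - a) (x - a) * beta n ^ k) ≤
              l (p x) * α (beta n ^ (k + 1)) := by
            rw [← h6] at h3
            have h8 := mul_le_mul_of_nonneg_left h3 (hh'0 (p x))
            rw [div_mul_eq_mul_div, div_le_iff₀ hHx]
            refine le_of_mul_le_mul_left ?_ hk0
            calc ((k : ℝ) + 1) * (h' (p x) * α (pairForm (x - a) (x - a) * beta n ^ k))
                = h' (p x) * (((k : ℝ) + 1) * α (pairForm (x - a) (x - a) * beta n ^ k)) := by ring
              _ ≤ _ := h8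
              _ = 2 * p x * h' (p x) * α (beta n ^ (k + 1)) := by ring
              _ = _ := by rw [h5]; ring
          have h9 : 0 ≤ g' x + g x / H x :=
            add_nonneg (hg'nn x) (div_nonneg (hgnn x) hHx.le)
          have h10 := mul_le_mul_of_nonneg_left h7 h9
          have h11 : 0 ≤ ((k : ℝ) + 1) * -B x *
              α (endForm (fderiv ℝ G x) * beta n ^ k) :=
            mul_nonneg (mul_nonneg hk0.le (neg_nonneg.2 h4)) h1
          have h12 := mul_nonneg hc h2
          nlinarith [h10, h11, h12]
        · rw [hψ0 x hx, map_zero]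
    have hsplit : T.onForms ψ = T.onFunctions (beta n ^ (k + 1)) (Ξ - Θ) := by
      rw [map_add, map_sub, map_smul, map_smul, hψC, hT.closed.onForms_eq_zero X hψX, smul_zero,
        sub_zero, add_zero, onFunctions_apply]
    have htr : ∀ f, T.trace f = ((k + 1).factorial : ℝ)⁻¹ * T.onFunctions (beta n ^ (k + 1)) f :=
      fun f => map_smul (T.onConstants f) _ _
    rw [hsplit] at hψnn
    rw [← sub_nonneg, ← map_sub, htr]
    exact mul_nonneg (inv_nonneg.2 (Nat.cast_nonneg _)) hψnn
  · by_cases hx : x ∈ K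
    · rw [hΞ x hx]
      have h1 := hl01 (p x) (hp0 x)
      exact ⟨mul_nonneg h1.1 (hg'nn x), mul_le_one₀ h1.2 (hg'nn x)
        (Real.smoothTransition.le_one _)⟩
    · rw [hΞ' x hx]
      exact ⟨le_rfl, zero_le_one⟩
  · by_cases hx : x ∈ K
    · rw [hΘ x hx]
      exact div_nonneg (mul_nonneg (sub_nonneg.2 (hl01 (p x) (hp0 x)).2) (hgnn x)) (hH0 x).le
    · rw [hΘ' x hx]
  · by_cases hxK : x ∈ K
    · rw [hΞ x hxK, (hhr (p x) (hp1 x hx)).2, zero_mul]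
    · exact hΞ' x hxK
  · have h1 := hhr (p x) (hp1 x hx)
    have h2 : g x = δ * softPos ((v x - r ^ (k + 1)) / δ) := by
      simp only [hg, hs, hH, h1.1]
    rw [← h2]
    by_cases hxK : x ∈ K
    · rw [hΘ x hxK, h1.2, sub_zero, one_mul, ← h1.1]
    · rw [hΘ' x hxK, hg0 x hxD hxK, zero_div]

end Supercurrent

/-! ### Comparison of masses and the density -/

namespace Supercurrent

variable {D : Opens (E n)} {k : ℕ} {T : Supercurrent D (k + 1) (k + 1)}

/-- If `v` is smooth, `{v > |x - a|^m}` is relatively compact in `D ∩ U`, and `d d^# v ∧ β^{m-1}`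
is weakly positive there, then a lower bound `c` of `v` on the ball of radius `r` bounds the
mass of `U` from below by `c r^{-m}` times the mass of the ball. -/
theorem IsMinimal.mass_ball_le (hT : T.IsMinimal) {v : E n → ℝ} (hv : ContDiff ℝ ∞ v)
    (hD : Bornology.IsBounded (D : Set (E n))) {a : E n} {K U : Set (E n)} (hK : IsCompact K)
    (hKD : K ⊆ D) (hKU : K ⊆ U) (hvK : ∀ x ∈ D, ‖x - a‖ ^ (k + 1) < v x → x ∈ K)
    (hpos : ∀ x ∈ K, ∀ α : Form n →ₗ[ℝ] ℝ, IsWeaklyPositiveForm (k + 1) α →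
      0 ≤ α (ddSharp v x * beta n ^ k))
    {r c : ℝ} (hr : 0 < r) (hrU : Metric.ball a r ⊆ U)
    (hc : ∀ x ∈ Metric.ball a r, c ≤ v x) :
    ENNReal.ofReal c * T.mass (Metric.ball a r) ≤ ENNReal.ofReal (r ^ (k + 1)) * T.mass U := by
  rcases le_or_gt c 0 with hc0 | hc0
  · simp [ENNReal.ofReal_of_nonpos hc0]
  have hrk : 0 < r ^ (k + 1) := pow_pos hr _
  have key : ∀ η : 𝓓(D, ℝ), (∀ x, 0 ≤ η x ∧ η x ≤ 1) → tsupport η ⊆ Metric.ball a r →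
      ∀ δ : ℝ, 0 < δ → ENNReal.ofReal ((c - δ) * T.trace η) ≤
        ENNReal.ofReal (r ^ (k + 1)) * T.mass U := by
    intro η hη hηr δ hδ
    obtain ⟨r', hr', hηr'⟩ := exists_lt_subset_ball (isClosed_tsupport η) hηr
    -- The ball of radius `r₁` still contains the support of `η`. The maximum with `r / 2` keeps
    -- `r₁` positive.
    set r₁ := max r' (r / 2) with hr₁
    have hr₁0 : 0 < r₁ := lt_max_of_lt_right (half_pos hr)
    have hr₁r : r₁ < r := max_lt hr' (half_lt_self hr)
    obtain ⟨Θ, Ξ, hΘΞ, hΞK, hΞ01, hΘ0, hΞ0, hΘ⟩ :=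
      hT.trace_le hv hD hK hKD hvK hpos hr₁0 hr₁r hδ
    have hηx : ∀ x, η x ≠ 0 → ‖x - a‖ ≤ r₁ := fun x hx =>
      (mem_ball_iff_norm.1 (hηr' (subset_tsupport _ hx))).le.trans (le_max_left _ _)
    set q := δ * softPos ((c - r ^ (k + 1)) / δ) / r ^ (k + 1) with hq
    have hη0 : 0 ≤ T.trace η := by
      rw [← map_zero T.trace]
      exact hT.positive.trace_mono fun x => (hη x).1
    have h1 : q * T.trace η ≤ T.trace Θ := by
      rw [← smul_eq_mul, ← map_smul]
      refine hT.positive.trace_mono fun x => ?_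
      change q * η x ≤ Θ x
      by_cases hx : η x = 0
      · rw [hx, mul_zero]
        exact hΘ0 x
      · have hxs := subset_tsupport η hx
        rw [hΘ x (η.tsupport_subset hxs) (hηx x hx)]
        have hq0 : 0 ≤ q := div_nonneg (mul_nonneg hδ.le (softPos_nonneg _)) hrk.le
        refine (mul_le_of_le_one_right hq0 (hη x).2).trans ?_
        have := hc x (hηr hxs)
        rw [hq]
        gcongr
        exact monotone_softPos (by gcongr)
    have h2 : T.trace (Ξ + η) = T.trace Ξ + T.trace η := map_add _ _ _
    -- Since `Ξ` vanishes wherever `η` does not, the sum is still at most one and competes in the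
    -- mass of `U`. This adds the mass of the ball to the exterior mass and turns the factor `c -
    -- r^m` into `c`.
    have h3 : ENNReal.ofReal (T.trace (Ξ + η)) ≤ T.mass U := by
      refine le_mass _ (fun x => ?_) ?_
      · change 0 ≤ Ξ x + η x ∧ Ξ x + η x ≤ 1
        by_cases hx : η x = 0
        · rw [hx, add_zero]
          exact hΞ01 x
        · rw [hΞ0 x (hηx x hx), zero_add]
          exact hη x
      · exact (tsupport_add Ξ η).trans (union_subset (hΞK.trans hKU) (hηr.trans hrU))
    -- Replacing the positive part by its smooth version costs at most `δ`.
    have h4 : c - r ^ (k + 1) - δ ≤ q * r ^ (k + 1) := by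
      have h5 := mul_le_mul_of_nonneg_left (sub_one_le_softPos ((c - r ^ (k + 1)) / δ)) hδ.le
      rw [mul_sub, mul_div_cancel₀ _ hδ.ne', mul_one] at h5
      rw [hq, div_mul_cancel₀ _ hrk.ne']
      exact h5
    have h5 : (c - δ) * T.trace η ≤ r ^ (k + 1) * T.trace (Ξ + η) := by
      rw [h2]
      calc (c - δ) * T.trace η ≤ (q * r ^ (k + 1) + r ^ (k + 1)) * T.trace η :=
            mul_le_mul_of_nonneg_right (by linarith) hη0
        _ = r ^ (k + 1) * (q * T.trace η + T.trace η) := by ring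
        _ ≤ r ^ (k + 1) * (T.trace Ξ + T.trace η) :=
            mul_le_mul_of_nonneg_left (by linarith) hrk.le
    refine (ENNReal.ofReal_le_ofReal h5).trans ?_
    rw [ENNReal.ofReal_mul hrk.le]
    gcongr
  have hc0' : ENNReal.ofReal c ≠ 0 := (ENNReal.ofReal_pos.2 hc0).ne'
  rw [mul_comm, ← ENNReal.le_div_iff_mul_le (Or.inl hc0') (Or.inl ENNReal.ofReal_ne_top)]
  refine mass_le fun η hη hηr => ?_
  rw [ENNReal.le_div_iff_mul_le (Or.inl hc0') (Or.inl ENNReal.ofReal_ne_top), mul_comm,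
    ← ENNReal.ofReal_mul hc0.le]
  have hlim : Tendsto (fun δ : ℝ => ENNReal.ofReal ((c - δ) * T.trace η)) (𝓝[>] 0)
      (𝓝 (ENNReal.ofReal ((c - 0) * T.trace η))) :=
    (ENNReal.continuous_ofReal.comp ((continuous_const.sub continuous_id).mul
      continuous_const)).tendsto 0 |>.mono_left nhdsWithin_le_nhds
  rw [sub_zero] at hlim
  exact le_of_tendsto hlim (eventually_nhdsWithin_of_forall fun δ hδ => key η hη hηr δ hδ)

lemma ddSharp_const (c : ℝ) (x : E n) : ddSharp (fun _ : E n => c) x = 0 := by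
  rw [ddSharp_eq_endForm (G := fun _ => 0) (fun y => by simpa using hasFDerivAt_const c y)
    (differentiable_const 0), fderiv_const_apply, map_zero]

/-- The monotonicity formula. -/
lemma IsMinimal.mass_ball_div_mono (hT : T.IsMinimal)
    (hD : Bornology.IsBounded (D : Set (E n))) {a : E n} {r R : ℝ} (hr : 0 < r) (hrR : r ≤ R)
    (hR : Metric.ball a R ⊆ D) :
    T.mass (Metric.ball a r) / ENNReal.ofReal (r ^ (k + 1)) ≤
      T.mass (Metric.ball a R) / ENNReal.ofReal (R ^ (k + 1)) := by
  rcases hrR.eq_or_lt with rfl | hrR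
  · rfl
  have hR0 : 0 < R := hr.trans hrR
  -- For the constant `R'^m` the superlevel set lies in the closed ball of radius `R'`, compact in
  -- the open ball of radius `R` because `R' < R`. Afterwards `R'` tends to `R`.
  have key : ∀ R' ∈ Ioo 0 R, ENNReal.ofReal (R' ^ (k + 1)) * T.mass (Metric.ball a r) ≤
      ENNReal.ofReal (r ^ (k + 1)) * T.mass (Metric.ball a R) := fun R' hR' => by
    have hsub := Metric.closedBall_subset_ball (x := a) hR'.2
    refine hT.mass_ball_le (v := fun _ => R' ^ (k + 1)) contDiff_const hD
      (isCompact_closedBall a R') (hsub.trans hR) hsub (fun x _ hx => ?_) (fun x _ α _ => ?_) hr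
      (Metric.ball_subset_ball hrR.le) fun x _ => le_rfl
    · exact mem_closedBall_iff_norm.2 (lt_of_pow_lt_pow_left₀ _ hR'.1.le hx).le
    · rw [ddSharp_const, zero_mul, map_zero]
  have hlim : Tendsto (fun R' : ℝ => ENNReal.ofReal (R' ^ (k + 1)) * T.mass (Metric.ball a r))
      (𝓝[<] R) (𝓝 (ENNReal.ofReal (R ^ (k + 1)) * T.mass (Metric.ball a r))) := by
    refine ENNReal.Tendsto.mul_const ?_ (Or.inl (ENNReal.ofReal_pos.2 (pow_pos hR0 _)).ne')
    exact ((ENNReal.continuous_ofReal.comp (continuous_pow (k + 1))).tendsto R).mono_left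
      nhdsWithin_le_nhds
  have h := le_of_tendsto hlim (mem_of_superset (Ioo_mem_nhdsLT hR0) key)
  have h1 : ENNReal.ofReal (r ^ (k + 1)) ≠ 0 := (ENNReal.ofReal_pos.2 (pow_pos hr _)).ne'
  have h2 : ENNReal.ofReal (R ^ (k + 1)) ≠ 0 := (ENNReal.ofReal_pos.2 (pow_pos hR0 _)).ne'
  rw [ENNReal.div_le_iff h1 ENNReal.ofReal_ne_top, mul_comm,
    ← mul_div_assoc, ENNReal.le_div_iff_mul_le (Or.inl h2) (Or.inl ENNReal.ofReal_ne_top)]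
  rw [mul_comm] at h
  exact h

/-- The density of a minimal supercurrent exists. -/
lemma IsMinimal.exists_hasDensity (hT : T.IsMinimal)
    (hD : Bornology.IsBounded (D : Set (E n))) {a : E n} (ha : a ∈ D) :
    ∃ γ : ℝ≥0, T.HasDensity a γ := by
  obtain ⟨R, hR, hRD⟩ := Metric.nhds_basis_closedBall.mem_iff.1 (D.isOpen.mem_nhds ha)
  set f : ℝ → ℝ≥0∞ := fun r => T.mass (Metric.ball a r) / ENNReal.ofReal (r ^ (k + 1)) with hf
  have hmono : MonotoneOn f (Ioo 0 R) := fun r hr s hs hrs =>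
    hT.mass_ball_div_mono hD hr.1 hrs
      ((Metric.ball_subset_closedBall.trans (Metric.closedBall_subset_closedBall hs.2.le)).trans
        hRD)
  have hlim : Tendsto f (𝓝[>] 0) (𝓝 (sInf (f '' Ioo 0 R))) :=
    hmono.tendsto_nhdsWithin_Ioo_right ⟨R / 2, half_pos hR, half_lt_self hR⟩ (OrderBot.bddBelow _)
  have hfin : sInf (f '' Ioo 0 R) ≠ ⊤ := by
    have hR2 : R / 2 ∈ Ioo 0 R := ⟨half_pos hR, half_lt_self hR⟩
    refine ((sInf_le (mem_image_of_mem f hR2)).trans_lt (ENNReal.div_lt_top ?_ ?_)).ne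
    · exact (hT.positive.mass_lt_top (isCompact_closedBall a R) hRD
        ((Metric.ball_subset_ball hR2.2.le).trans Metric.ball_subset_closedBall)).ne
    · exact (ENNReal.ofReal_pos.2 (pow_pos hR2.1 _)).ne'
  refine ⟨(sInf (f '' Ioo 0 R)).toNNReal, ?_⟩
  rw [HasDensity, ENNReal.coe_toNNReal hfin]
  exact hlim

/-- The lower bound for the mass of `D` in terms of a smooth function and the density. -/
lemma IsMinimal.mul_density_le (hT : T.IsMinimal) {v : E n → ℝ} (hv : ContDiff ℝ ∞ v)
    (hD : Bornology.IsBounded (D : Set (E n))) {a : E n} (ha : a ∈ D) {K : Set (E n)}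
    (hK : IsCompact K) (hKD : K ⊆ D) (hvK : ∀ x ∈ D, ‖x - a‖ ^ (k + 1) < v x → x ∈ K)
    (hpos : ∀ x ∈ K, ∀ α : Form n →ₗ[ℝ] ℝ, IsWeaklyPositiveForm (k + 1) α →
      0 ≤ α (ddSharp v x * beta n ^ k)) {γ : ℝ≥0} (hγ : T.HasDensity a γ) {c : ℝ}
    (hc : c < v a) : ENNReal.ofReal c * γ ≤ T.mass (D : Set (E n)) := by
  have h1 : ∀ᶠ r in 𝓝[>] (0 : ℝ), Metric.ball a r ⊆ D ∩ {x | c < v x} := by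
    have hmem : (D : Set (E n)) ∩ {x | c < v x} ∈ 𝓝 a :=
      inter_mem (D.isOpen.mem_nhds ha) ((isOpen_lt continuous_const hv.continuous).mem_nhds hc)
    obtain ⟨ε, hε, hsub⟩ := Metric.mem_nhds_iff.1 hmem
    filter_upwards [Ioo_mem_nhdsGT hε] with r hr
    exact (Metric.ball_subset_ball hr.2.le).trans hsub
  have hlim : Tendsto (fun r : ℝ => ENNReal.ofReal c *
      (T.mass (Metric.ball a r) / ENNReal.ofReal (r ^ (k + 1)))) (𝓝[>] 0)
      (𝓝 (ENNReal.ofReal c * γ)) :=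
    ENNReal.Tendsto.const_mul hγ (Or.inr ENNReal.ofReal_ne_top)
  refine le_of_tendsto hlim ?_
  filter_upwards [h1, self_mem_nhdsWithin] with r hr hr0
  have h2 := hT.mass_ball_le hv hD hK hKD hKD hvK hpos hr0 (hr.trans inter_subset_left)
    fun x hx => (hr hx).2.le
  have h3 : ENNReal.ofReal (r ^ (k + 1)) ≠ 0 := (ENNReal.ofReal_pos.2 (pow_pos hr0 _)).ne'
  rw [← mul_div_assoc, ENNReal.div_le_iff h3 ENNReal.ofReal_ne_top, mul_comm (T.mass _)]
  exact h2

end Supercurrent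

/-! ### Regularization -/

/-- The convolution of a function with a mollifier. -/
def mollify (f κ : E n → ℝ) : E n → ℝ := convolution f κ (ContinuousLinearMap.lsmul ℝ ℝ) volume

lemma mollify_apply (f κ : E n → ℝ) (x : E n) : mollify f κ x = ∫ y, f y * κ (x - y) := rfl

lemma mollify_apply_swap (f κ : E n → ℝ) (x : E n) : mollify f κ x = ∫ y, f (x - y) * κ y := by
  rw [mollify_apply, ← integral_sub_left_eq_self _ volume x]
  simp

lemma contDiff_mollify {f κ : E n → ℝ} (hf : LocallyIntegrable f) (hκ : ContDiff ℝ ∞ κ)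
    (hκc : HasCompactSupport κ) : ContDiff ℝ ∞ (mollify f κ) :=
  hκc.contDiff_convolution_right _ hf hκ

lemma hasCompactSupport_gradient {κ : E n → ℝ} (hκc : HasCompactSupport κ) :
    HasCompactSupport (gradient κ) :=
  (hκc.fderiv (𝕜 := ℝ)).comp_left (g := (InnerProductSpace.toDual ℝ (E n)).symm) (map_zero _)

lemma integrable_mul_comp_sub {F : Type*} [NormedAddCommGroup F] [NormedSpace ℝ F]
    {f : E n → ℝ} {g : E n → F} (hf : LocallyIntegrable f)
    (hg : Continuous g) (hgc : HasCompactSupport g) (x : E n) :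
    Integrable fun y => f y • g (x - y) :=
  hgc.convolutionExists_right (ContinuousLinearMap.lsmul ℝ ℝ) hf hg x

lemma hasFDerivAt_mollify {f κ : E n → ℝ} (hf : LocallyIntegrable f) (hκ : ContDiff ℝ ∞ κ)
    (hκc : HasCompactSupport κ) (x : E n) :
    HasFDerivAt (mollify f κ) (innerSL ℝ (∫ y, f y • gradient κ (x - y))) x := by
  have h := hκc.hasFDerivAt_convolution_right (ContinuousLinearMap.lsmul ℝ ℝ) hf
    (hκ.of_le (by simp)) x
  refine h.congr_fderiv ?_
  rw [convolution_def, ← ContinuousLinearMap.integral_comp_comm _ (integrable_mul_comp_sub hf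
    (contDiff_gradient hκ).continuous (hasCompactSupport_gradient hκc) x)]
  refine integral_congr_ae (Eventually.of_forall fun y => ?_)
  simp only [map_smul]
  rw [← (hasFDerivAt_gradient hκ (x - y)).fderiv]
  ext z
  simp [ContinuousLinearMap.precompR_apply]

lemma gradient_mollify {f κ : E n → ℝ} (hf : LocallyIntegrable f) (hκ : ContDiff ℝ ∞ κ)
    (hκc : HasCompactSupport κ) (x : E n) :
    gradient (mollify f κ) x = ∫ y, f y • gradient κ (x - y) :=
  HasGradientAt.gradient (hasGradientAt_iff_hasFDerivAt.2 (hasFDerivAt_mollify hf hκ hκc x))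

lemma hasFDerivAt_gradient_mollify {f κ : E n → ℝ} (hf : LocallyIntegrable f)
    (hκ : ContDiff ℝ ∞ κ) (hκc : HasCompactSupport κ) (x : E n) :
    HasFDerivAt (gradient (mollify f κ)) (∫ y, f y • fderiv ℝ (gradient κ) (x - y)) x := by
  have h := (hasCompactSupport_gradient hκc).hasFDerivAt_convolution_right
    (ContinuousLinearMap.lsmul ℝ ℝ) hf ((contDiff_gradient hκ).of_le (by simp)) x
  rw [show gradient (mollify f κ) = _ from funext fun x => gradient_mollify hf hκ hκc x]
  refine h.congr_fderiv ?_
  rw [convolution_def]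
  refine integral_congr_ae (Eventually.of_forall fun y => ?_)
  ext z
  simp [ContinuousLinearMap.precompR_apply]

lemma ddSharp_eq_endForm_gradient {v : E n → ℝ} (hv : ContDiff ℝ ∞ v) (x : E n) :
    ddSharp v x = endForm (fderiv ℝ (gradient v) x) :=
  ddSharp_eq_endForm (hasFDerivAt_gradient hv) ((contDiff_gradient hv).differentiable (by simp)) x

lemma ddSharp_comp_sub_left {κ : E n → ℝ} (hκ : ContDiff ℝ ∞ κ) (x y : E n) :
    ddSharp (fun z => κ (x - z)) y = ddSharp κ (x - y) := by
  have h0 : ∀ z, HasFDerivAt (fun z : E n => x - z) (-ContinuousLinearMap.id ℝ (E n)) z :=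
    fun z => (hasFDerivAt_id z).const_sub x
  have h1 : ∀ z, HasFDerivAt (fun z => κ (x - z)) (innerSL ℝ (-gradient κ (x - z))) z := fun z =>
    ((hasFDerivAt_gradient hκ (x - z)).comp z (h0 z)).congr_fderiv (by ext; simp)
  have h2 : HasFDerivAt (fun z => -gradient κ (x - z)) (fderiv ℝ (gradient κ) (x - y)) y :=
    ((((contDiff_gradient hκ).differentiable (by simp)) (x - y)).hasFDerivAt.comp y
      (h0 y)).neg.congr_fderiv (by ext1; simp)
  rw [ddSharp_eq_endForm h1 (((contDiff_gradient hκ).comp (contDiff_const.sub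
    contDiff_id)).neg.differentiable (by simp)), h2.fderiv, ddSharp_eq_endForm_gradient hκ]

/-- All derivatives fall on the kernel. The right-hand side is the pairing in the weak definition of
`m`-subharmonicity, with the reflected kernel as test function. -/
lemma apply_ddSharp_mollify {f κ : E n → ℝ} (hf : LocallyIntegrable f) (hκ : ContDiff ℝ ∞ κ)
    (hκc : HasCompactSupport κ) (k : ℕ) (α : Form n →ₗ[ℝ] ℝ) (x : E n) :
    α (ddSharp (mollify f κ) x * beta n ^ k) =
      ∫ y, f y * α (ddSharp (fun z => κ (x - z)) y * beta n ^ k) := by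
  have hi := integrable_mul_comp_sub hf ((contDiff_gradient hκ).continuous_fderiv (by simp))
    ((hasCompactSupport_gradient hκc).fderiv (𝕜 := ℝ)) x
  rw [ddSharp_eq_endForm_gradient (contDiff_mollify hf hκ hκc),
    (hasFDerivAt_gradient_mollify hf hκ hκc x).fderiv, ← endFormBeta_apply]
  have := ContinuousLinearMap.integral_comp_comm
    ((LinearMap.toContinuousLinearMap α).comp (endFormBeta k)) hi
  simp only [ContinuousLinearMap.comp_apply, LinearMap.coe_toContinuousLinearMap'] at this
  rw [← this]
  refine integral_congr_ae (Eventually.of_forall fun y => ?_)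
  simp only [map_smul, smul_eq_mul]
  rw [ddSharp_comp_sub_left hκ, ddSharp_eq_endForm_gradient hκ, endFormBeta_apply]

/-! ### Convex functions -/

/-- On the line through `x` in direction `u` the restriction is convex near `x`, so its derivative
is increasing there. The Hessian term is the derivative of that derivative. -/
lemma inner_fderiv_gradient_nonneg {v : E n → ℝ} (hv : ContDiff ℝ ∞ v) {x : E n} {s : ℝ}
    (hs : 0 < s) (hc : ConvexOn ℝ (Metric.ball x s) v) (u : E n) :
    0 ≤ inner ℝ (fderiv ℝ (gradient v) x u) u := by
  set l : ℝ → E n := fun t => AffineMap.lineMap x (x + u) t with hl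
  have hl' : ∀ t, HasDerivAt l u t := fun t => by
    simpa using AffineMap.hasDerivAt_lineMap (a := x) (b := x + u) (x := t)
  have hl0 : l 0 = x := by simp [hl]
  set S : Set ℝ := l ⁻¹' Metric.ball x s with hS
  have hSo : IsOpen S := Metric.isOpen_ball.preimage AffineMap.lineMap_continuous
  have h0 : (0 : ℝ) ∈ S := by simp [hS, hl0, hs]
  have hcS : ConvexOn ℝ S (v ∘ l) := hc.comp_affineMap _
  have hd : ∀ t, HasDerivAt (v ∘ l) (inner ℝ (gradient v (l t)) u) t := fun t =>
    (hasFDerivAt_gradient hv (l t)).comp_hasDerivAt t (hl' t)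
  have hmono := hcS.monotoneOn_deriv fun t _ => (hd t).differentiableAt
  have hderiv : deriv (v ∘ l) = fun t => inner ℝ (gradient v (l t)) u := funext fun t => (hd t).deriv
  rw [hderiv] at hmono
  have h2 : HasDerivAt (fun t => inner ℝ (gradient v (l t)) u)
      (inner ℝ (fderiv ℝ (gradient v) x u) u) 0 := by
    have hg := ((contDiff_gradient hv).differentiable (by simp) (l 0)).hasFDerivAt.comp_hasDerivAt
      0 (hl' 0)
    rw [hl0] at hg
    simpa using hg.inner ℝ (hasDerivAt_const (0 : ℝ) u)
  have := hmono.derivWithin_nonneg (x := 0)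
  rwa [derivWithin_of_isOpen hSo h0, h2.deriv] at this

/-- In an orthonormal eigenbasis of the Hessian, `dd^# v` is a combination of the `b_i ∧ b_i^#` with
nonnegative eigenvalues as coefficients. -/
lemma apply_ddSharp_nonneg_of_convexOn {v : E n → ℝ} (hv : ContDiff ℝ ∞ v) {x : E n} {s : ℝ}
    (hs : 0 < s) (hc : ConvexOn ℝ (Metric.ball x s) v) {k : ℕ} {α : Form n →ₗ[ℝ] ℝ}
    (hα : IsWeaklyPositiveForm (k + 1) α) : 0 ≤ α (ddSharp v x * beta n ^ k) := by
  have hsym : ((fderiv ℝ (gradient v) x : E n →L[ℝ] E n) : E n →ₗ[ℝ] E n).IsSymmetric :=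
    fun u w => inner_fderiv_gradient_comm hv x u w
  set b := hsym.eigenvectorBasis (n := n) (by simp)
  set l := hsym.eigenvalues (n := n) (by simp)
  have hb : ∀ i, fderiv ℝ (gradient v) x (b i) = l i • b i :=
    fun i => hsym.apply_eigenvectorBasis (by simp) i
  have hl : ∀ i, 0 ≤ l i := fun i => by
    have := inner_fderiv_gradient_nonneg hv hs hc (b i)
    rw [hb, real_inner_smul_left, real_inner_self_eq_norm_sq, b.orthonormal.1] at this
    simpa using this
  have hL : fderiv ℝ (gradient v) x = ∑ i, l i • (innerSL ℝ (b i)).smulRight (b i) := by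
    ext1 z
    conv_lhs => rw [← b.sum_repr' z]
    simp only [map_sum, map_smul, hb, FunLike.coe_sum, Finset.sum_apply,
      smul_apply, ContinuousLinearMap.smulRight_apply, innerSL_apply_apply]
    exact Finset.sum_congr rfl fun i _ => smul_comm _ _ _
  rw [ddSharp_eq_endForm_gradient hv, hL]
  simp only [map_sum, map_smul, endForm_smulRight, Finset.sum_mul, smul_mul_assoc, smul_eq_mul]
  exact Finset.sum_nonneg fun i _ => mul_nonneg (hl i) (hα.pairForm_nonneg _)

/-- A mollification is an integral of translates with nonnegative weights, and only translates by
the support of the kernel matter. -/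
lemma convexOn_mollify {f κ : E n → ℝ} (hf : LocallyIntegrable f) (hκ : Continuous κ)
    (hκc : HasCompactSupport κ) (hκ0 : ∀ y, 0 ≤ κ y) {s : Set (E n)} (hs : Convex ℝ s)
    (h : ∀ y, κ y ≠ 0 → ConvexOn ℝ s fun x => f (x - y)) : ConvexOn ℝ s (mollify f κ) := by
  have hi : ∀ x, Integrable fun y => f (x - y) * κ y := fun x => by
    have := (integrable_mul_comp_sub hf hκ hκc x).comp_sub_left x
    simpa using this
  refine ⟨hs, fun x hx y hy a b ha hb hab => ?_⟩
  simp only [mollify_apply_swap, smul_eq_mul]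
  rw [← integral_const_mul, ← integral_const_mul, ← integral_add ((hi x).const_mul a)
    ((hi y).const_mul b)]
  refine integral_mono (hi _) (((hi x).const_mul a).add ((hi y).const_mul b)) fun z => ?_
  rcases eq_or_ne (κ z) 0 with hz | hz
  · simp [hz]
  have := mul_le_mul_of_nonneg_right ((h z hz).2 hx hy ha hb hab) (hκ0 z)
  simp only [smul_eq_mul, add_mul, mul_assoc] at this
  exact this

/-! ### Sign of the Hessian of a regularization -/

/-- The regularizations of `w` satisfy `dd^# v ∧ β^k ≥ 0` in the weak sense, wherever they are
determined by the values of `w` on a ball contained in `D`. -/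
def HasPositiveMollifications (k : ℕ) (D : Opens (E n)) (w : E n → ℝ) : Prop :=
  ∀ (f κ : E n → ℝ) (x : E n) (r s : ℝ), LocallyIntegrable f → ContDiff ℝ ∞ κ →
    (∀ y, 0 ≤ κ y) → tsupport κ ⊆ Metric.closedBall 0 r → r < s → Metric.ball x s ⊆ D →
    EqOn f w (Metric.ball x s) → ∀ α : Form n →ₗ[ℝ] ℝ, IsWeaklyPositiveForm (k + 1) α →
      0 ≤ α (ddSharp (mollify f κ) x * beta n ^ k)

lemma hasCompactSupport_of_tsupport_subset {κ : E n → ℝ} {r : ℝ}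
    (h : tsupport κ ⊆ Metric.closedBall 0 r) : HasCompactSupport κ :=
  (isCompact_closedBall 0 r).of_isClosed_subset (isClosed_tsupport κ) h

lemma ddSharp_eq_zero_of_notMem {χ : E n → ℝ} (hχ : ContDiff ℝ ∞ χ) {x : E n}
    (hx : x ∉ tsupport χ) : ddSharp χ x = 0 := by
  have h0 : χ =ᶠ[𝓝 x] fun _ => 0 := notMem_tsupport_iff_eventuallyEq.1 hx
  have h1 : gradient χ =ᶠ[𝓝 x] fun _ => 0 := by
    simpa using h0.gradient
  rw [ddSharp_eq_endForm_gradient hχ, h1.fderiv_eq, fderiv_const_apply, map_zero]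

lemma IsMSubharmonic.hasPositiveMollifications {k : ℕ} {D : Opens (E n)} {w : E n → ℝ}
    (hw : IsMSubharmonic (k + 1) D w) : HasPositiveMollifications k D w := by
  intro f κ x r s hf hκ hκ0 hκr hrs hsD hfw α hα
  have hκc := hasCompactSupport_of_tsupport_subset hκr
  have hsm : ContDiff ℝ ∞ fun y => κ (x - y) := hκ.comp (contDiff_const.sub contDiff_id)
  have hts : tsupport (fun y => κ (x - y)) ⊆ Metric.closedBall x r := by
    refine closure_minimal (fun y hy => ?_) Metric.isClosed_closedBall
    have := hκr (subset_tsupport _ hy)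
    rw [mem_closedBall_zero_iff] at this
    rwa [Metric.mem_closedBall, dist_comm, dist_eq_norm]
  have htb : tsupport (fun y => κ (x - y)) ⊆ Metric.ball x s :=
    hts.trans (Metric.closedBall_subset_ball hrs)
  let χ : 𝓓(D, ℝ) := ⟨fun y => κ (x - y), hsm,
    (isCompact_closedBall x r).of_isClosed_subset (isClosed_tsupport _) hts, htb.trans hsD⟩
  have h := hw.2 α hα χ fun y => hκ0 _
  rw [apply_ddSharp_mollify hf hκ hκc]
  rw [setIntegral_eq_integral_of_forall_compl_eq_zero] at h
  · refine h.trans_eq (integral_congr_ae (Eventually.of_forall fun y => ?_))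
    by_cases hy : y ∈ tsupport fun y => κ (x - y)
    · simp only [hfw (htb hy)]; rfl
    · change w y * α (ddSharp (fun y => κ (x - y)) y * beta n ^ k) =
        f y * α (ddSharp (fun y => κ (x - y)) y * beta n ^ k)
      rw [ddSharp_eq_zero_of_notMem hsm hy, zero_mul, map_zero, mul_zero, mul_zero]
  · intro y hy
    change w y * α (ddSharp (fun y => κ (x - y)) y * beta n ^ k) = 0
    rw [ddSharp_eq_zero_of_notMem hsm fun h => hy (hsD (htb h)), zero_mul, map_zero, mul_zero]

lemma ConvexAlongSegments.convexOn {C s : Set (E n)} {w : E n → ℝ} (hw : ConvexAlongSegments C w)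
    (hs : Convex ℝ s) (hsC : s ⊆ C) : ConvexOn ℝ s w :=
  ⟨hs, fun x hx y hy => (hw x y ((hs.segment_subset hx hy).trans hsC)).2
    (left_mem_segment ℝ x y) (right_mem_segment ℝ x y)⟩

/-- Translates by vectors of length at most `r` are convex on the concentric ball of radius `s - r`,
which suffices for the Hessian at the centre. -/
lemma ConvexAlongSegments.hasPositiveMollifications {k : ℕ} {D : Opens (E n)} {w : E n → ℝ}
    (hw : ConvexAlongSegments (closure (D : Set (E n))) w) : HasPositiveMollifications k D w := by
  intro f κ x r s hf hκ hκ0 hκr hrs hsD hfw α hα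
  have hκc := hasCompactSupport_of_tsupport_subset hκr
  refine apply_ddSharp_nonneg_of_convexOn (contDiff_mollify hf hκ hκc) (sub_pos.2 hrs)
    (convexOn_mollify hf hκ.continuous hκc hκ0 (convex_ball _ _) fun y hy => ?_) hα
  have hyr : ‖y‖ ≤ r := mem_closedBall_zero_iff.1 (hκr (subset_tsupport _ hy))
  have hmem : ∀ z ∈ Metric.ball x (s - r), z - y ∈ Metric.ball x s := fun z hz => by
    rw [mem_ball_iff_norm] at hz ⊢
    calc ‖z - y - x‖ = ‖(z - x) - y‖ := by congr 1; abel
      _ ≤ ‖z - x‖ + ‖y‖ := norm_sub_le _ _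
      _ < s := by linarith
  have hc := hw.convexOn (convex_ball x s) (hsD.trans subset_closure)
  refine ⟨convex_ball _ _, fun p hp q hq b c hb hc' hbc => ?_⟩
  have hpq := (convex_ball x (s - r)) hp hq hb hc' hbc
  simp only [hfw (hmem _ hp), hfw (hmem _ hq), hfw (hmem _ hpq)]
  refine le_trans (le_of_eq ?_) (hc.2 (hmem _ hp) (hmem _ hq) hb hc' hbc)
  congr 1
  rw [smul_sub, smul_sub, ← add_sub_add_comm, ← add_smul, hbc, one_smul]

lemma ConvexAlongSegments.continuousOn {D : Opens (E n)} {w : E n → ℝ}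
    (hw : ConvexAlongSegments (closure (D : Set (E n))) w) : ContinuousOn w D := fun x hx => by
  obtain ⟨s, hs, hsD⟩ := Metric.mem_nhds_iff.1 (D.isOpen.mem_nhds hx)
  exact (((hw.convexOn (convex_ball x s) (hsD.trans subset_closure)).continuousOn
    Metric.isOpen_ball).continuousAt (Metric.ball_mem_nhds x hs)).continuousWithinAt

lemma tendsto_setAverage_ball {w : E n → ℝ} {U : Set (E n)} (hU : IsOpen U)
    (hw : ContinuousOn w U) {a : E n} (ha : a ∈ U) :
    Tendsto (fun r : ℝ => ⨍ y in Metric.ball a r, w y) (𝓝[>] 0) (𝓝 (w a)) := by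
  refine Metric.nhds_basis_closedBall.tendsto_right_iff.2 fun ε hε => ?_
  have h : w ⁻¹' Metric.closedBall (w a) ε ∈ 𝓝 a :=
    (hw.continuousAt (hU.mem_nhds ha)) (Metric.closedBall_mem_nhds _ hε)
  obtain ⟨s, hs, hsub⟩ := Metric.nhds_basis_closedBall.mem_iff.1
    (inter_mem h (hU.mem_nhds ha))
  filter_upwards [Ioc_mem_nhdsGT hs] with r hr
  have hrs : Metric.ball a r ⊆ Metric.closedBall a s :=
    Metric.ball_subset_closedBall.trans (Metric.closedBall_subset_closedBall hr.2)
  refine (convex_closedBall _ _).set_average_mem Metric.isClosed_closedBall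
    (Metric.measure_ball_pos _ _ hr.1).ne' measure_ball_lt_top.ne ?_ ?_
  · exact (ae_restrict_iff' measurableSet_ball).2 (Eventually.of_forall fun y hy =>
      (hsub (hrs hy)).1)
  · exact ((hw.mono fun y hy => (hsub hy).2).integrableOn_compact
      (isCompact_closedBall a s)).mono_set hrs

/-! ### Behaviour at the boundary -/

/-- A nearest point of the complement serves: the open ball up to it lies in `D`, so the point is in
the closure of `D`. -/
lemma exists_frontier_dist_eq (D : Opens (E n)) (hne : ((D : Set (E n))ᶜ).Nonempty) {x : E n}
    (hx : x ∈ D) : ∃ y ∈ frontier (D : Set (E n)), Metric.infDist x (D : Set (E n))ᶜ = dist x y := by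
  obtain ⟨y, hy, hxy⟩ := D.isOpen.isClosed_compl.exists_infDist_eq_dist hne x
  refine ⟨y, ?_, hxy⟩
  have hpos : dist x y ≠ 0 := dist_ne_zero.2 fun h => hy (h ▸ hx)
  rw [D.isOpen.frontier_eq]
  refine ⟨?_, hy⟩
  have hsub : Metric.ball x (dist x y) ⊆ D := fun z hz => by
    by_contra hz'
    have := Metric.infDist_le_dist_of_mem (x := x) (show z ∈ (D : Set (E n))ᶜ from hz')
    rw [hxy] at this
    exact absurd (Metric.mem_ball'.1 hz) (not_lt.2 this)
  have := closure_mono hsub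
  rw [closure_ball x hpos] at this
  exact this (Metric.mem_closedBall'.2 le_rfl)

/-- `w` is asymptotically at most `g` at the boundary of `D`. -/
def BoundaryLE (D : Opens (E n)) (w g : E n → ℝ) : Prop :=
  ∀ δ > 0, ∃ ε > 0, ∀ x ∈ D, Metric.infDist x (D : Set (E n))ᶜ < ε → w x ≤ g x + δ

/-- The estimate holds near each boundary point, and compactness of the boundary makes the
neighbourhood a uniform tube. -/
lemma boundaryLE_of_upperSemicontinuousOn {D : Opens (E n)}
    (hD : Bornology.IsBounded (D : Set (E n))) (hne : ((D : Set (E n))ᶜ).Nonempty)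
    {w g : E n → ℝ} (hw : UpperSemicontinuousOn w (closure (D : Set (E n)))) (hg : Continuous g)
    (hbd : ∀ x ∈ frontier (D : Set (E n)), w x ≤ g x) : BoundaryLE D w g := by
  intro δ hδ
  have hK : IsCompact (frontier (D : Set (E n))) :=
    Metric.isCompact_of_isClosed_isBounded isClosed_frontier
      (hD.closure.subset frontier_subset_closure)
  have hU : {x | x ∈ D → w x ≤ g x + δ} ∈ 𝓝ˢ (frontier (D : Set (E n))) := by
    refine mem_nhdsSet_iff_forall.2 fun y hy => ?_
    have h1 := eventually_nhdsWithin_iff.1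
      (hw y (frontier_subset_closure hy) (g y + δ / 2) (by linarith [hbd y hy]))
    have h2 : ∀ᶠ x in 𝓝 y, g y - δ / 2 < g x :=
      hg.continuousAt.eventually (lt_mem_nhds (by linarith))
    filter_upwards [h1, h2] with x hx1 hx2 hxD
    linarith [hx1 (subset_closure hxD)]
  obtain ⟨ε, hε, hsub⟩ := (Metric.hasBasis_nhdsSet_thickening hK).mem_iff.1 hU
  refine ⟨ε, hε, fun x hx hxε => hsub ?_ hx⟩
  obtain ⟨y, hy, hxy⟩ := exists_frontier_dist_eq D hne hx
  exact Metric.mem_thickening_iff.2 ⟨y, hy, hxy ▸ hxε⟩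

/-- The ray from `y` through `x`, which stays in a bounded open set up to `x`, meets the boundary
beyond `x` at a point `z`, and the chord from `y` to `z` lies in the closure. -/
lemma exists_chord {D : Opens (E n)} (hD : Bornology.IsBounded (D : Set (E n))) {x y : E n}
    (hxy : x ≠ y)
    (hseg : ∀ t ∈ Ioc (0 : ℝ) 1, AffineMap.lineMap y x t ∈ D) :
    ∃ z ∈ frontier (D : Set (E n)), ∃ t ≥ (1 : ℝ), z = AffineMap.lineMap y x t ∧
      segment ℝ y z ⊆ closure (D : Set (E n)) := by
  set l : ℝ → E n := fun t => AffineMap.lineMap y x t with hl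
  have hlc : Continuous l := AffineMap.lineMap_continuous
  have hnorm : ∀ t, ‖l t - y‖ = |t| * ‖x - y‖ := fun t => by
    simp [hl, AffineMap.lineMap_apply, norm_smul]
  have hpos : 0 < ‖x - y‖ := norm_pos_iff.2 (sub_ne_zero.2 hxy)
  -- Parameters from `1` on at which the ray is outside `D`. The least of them is the first exit
  -- after `x`, and boundedness of `D` ensures that there is one.
  set S : Set ℝ := Ici 1 ∩ l ⁻¹' (D : Set (E n))ᶜ with hS
  have hSc : IsClosed S := isClosed_Ici.inter (D.isOpen.isClosed_compl.preimage hlc)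
  have hSne : S.Nonempty := by
    obtain ⟨R, hR⟩ := hD.subset_closedBall y
    refine ⟨max 1 ((R + 1) / ‖x - y‖), mem_Ici.2 (le_max_left _ _), fun h => ?_⟩
    have h1 := mem_closedBall_iff_norm.1 (hR h)
    rw [hnorm, abs_of_pos (lt_max_of_lt_left one_pos)] at h1
    have h2 : R + 1 ≤ max 1 ((R + 1) / ‖x - y‖) * ‖x - y‖ :=
      (div_le_iff₀ hpos).1 (le_max_right _ _)
    linarith
  have hSb : BddBelow S := ⟨1, fun t ht => ht.1⟩
  set t₀ := sInf S with ht₀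
  have ht₀S : t₀ ∈ S := hSc.csInf_mem hSne hSb
  have hlt : ∀ t ∈ Ioo 0 t₀, l t ∈ D := fun t ht => by
    rcases le_total t 1 with h | h
    · exact hseg t ⟨ht.1, h⟩
    · by_contra hc
      exact absurd (csInf_le hSb (show t ∈ S from ⟨h, hc⟩)) (not_le.2 ht.2)
  have ht0 : (0 : ℝ) < t₀ := one_pos.trans_le ht₀S.1
  have hIcc : ∀ t ∈ Icc 0 t₀, l t ∈ closure (D : Set (E n)) := fun t ht => by
    have h1 : l '' closure (Ioo 0 t₀) ⊆ closure (l '' Ioo 0 t₀) :=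
      image_closure_subset_closure_image hlc
    rw [closure_Ioo ht0.ne] at h1
    exact closure_mono (image_subset_iff.2 hlt) (h1 (mem_image_of_mem _ ht))
  refine ⟨l t₀, ?_, t₀, ht₀S.1, rfl, ?_⟩
  · rw [D.isOpen.frontier_eq]
    exact ⟨hIcc t₀ (right_mem_Icc.2 ht0.le), ht₀S.2⟩
  · rw [segment_eq_image_lineMap]
    rintro _ ⟨s, hs, rfl⟩
    have : AffineMap.lineMap y (l t₀) s = l (s * t₀) := by
      simp [hl, AffineMap.lineMap_apply, smul_smul]
    rw [this]
    exact hIcc _ ⟨mul_nonneg hs.1 ht0.le, mul_le_of_le_one_left ht0.le hs.2⟩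

/-- Draw the chord from a nearest boundary point `y` through `x` to its exit `z`. Convexity gives
`w(x) ≤ (1 - 1/t) g(y) + g(z)/t`, where `|z - y| = t |x - y|`. The Lipschitz error at `z`, of size
`L t |x - y|`, is weighted by `1/t`, so it is small however far away `z` lies. -/
lemma boundaryLE_of_convexAlongSegments {D : Opens (E n)}
    (hD : Bornology.IsBounded (D : Set (E n))) (hne : ((D : Set (E n))ᶜ).Nonempty)
    {w g : E n → ℝ} (hw : ConvexAlongSegments (closure (D : Set (E n))) w) {L : ℝ≥0}
    (hg : LipschitzOnWith L g (closure (D : Set (E n))))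
    (hbd : ∀ x ∈ frontier (D : Set (E n)), w x = g x) : BoundaryLE D w g := by
  have key : ∀ x ∈ D, w x ≤ g x + 2 * L * Metric.infDist x (D : Set (E n))ᶜ := fun x hx => by
    obtain ⟨y, hy, hxy⟩ := exists_frontier_dist_eq D hne hx
    have hyD : y ∉ D := fun h => (D.isOpen.frontier_eq ▸ hy).2 h
    have hne : x ≠ y := fun h => hyD (h ▸ hx)
    obtain ⟨z, hz, t, ht, rfl, hseg⟩ := exists_chord hD hne fun t ht => by
      -- Points of the half-open segment are nearer to `x` than the complement is, so they lie in
      -- `D`.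
      by_contra hc
      have h1 := Metric.infDist_le_dist_of_mem (x := x)
        (show AffineMap.lineMap y x t ∈ (D : Set (E n))ᶜ from hc)
      have h2 : dist x (AffineMap.lineMap y x t) = |1 - t| * dist x y := by
        rw [dist_right_lineMap, Real.norm_eq_abs, dist_comm y x]
      rw [hxy, h2, abs_of_nonneg (by linarith [ht.2])] at h1
      nlinarith [dist_pos.2 hne, ht.1]
    have ht0 : 0 < t := one_pos.trans_le ht
    have hyz := (hw _ _ hseg).2 (left_mem_segment ℝ _ _) (right_mem_segment ℝ _ _)
      (sub_nonneg.2 (inv_le_one_of_one_le₀ ht)) (inv_nonneg.2 ht0.le) (sub_add_cancel 1 t⁻¹)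
    have hx' : (1 - t⁻¹) • y + t⁻¹ • (AffineMap.lineMap y x t : E n) = x := by
      rw [AffineMap.lineMap_apply_module]
      rw [smul_add, smul_smul, smul_smul, inv_mul_cancel₀ ht0.ne', mul_sub, inv_mul_cancel₀ ht0.ne',
        mul_one, ← add_assoc, ← add_smul, one_smul]
      simp
    rw [hx', hbd y hy, hbd _ hz, smul_eq_mul, smul_eq_mul] at hyz
    have hzy : dist (AffineMap.lineMap y x t) y = t * dist x y := by
      rw [dist_lineMap_left, Real.norm_eq_abs, abs_of_pos ht0, dist_comm y x]
    have h1 := (abs_le.1 (hg.dist_le_mul _ (frontier_subset_closure hz) _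
      (frontier_subset_closure hy))).2
    have h2 := (abs_le.1 (hg.dist_le_mul _ (frontier_subset_closure hy) _
      (subset_closure hx))).2
    rw [hzy] at h1
    rw [dist_comm y x] at h2
    rw [hxy]
    have h3 : t⁻¹ * g (AffineMap.lineMap y x t) ≤ t⁻¹ * (g y + L * (t * dist x y)) :=
      mul_le_mul_of_nonneg_left (by linarith) (inv_nonneg.2 ht0.le)
    have h4 : t⁻¹ * (g y + L * (t * dist x y)) = t⁻¹ * g y + L * dist x y := by
      field_simp
    linarith
  intro δ hδ
  refine ⟨δ / (2 * L + 1), by positivity, fun x hx hxε => (key x hx).trans ?_⟩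
  have h0 : (0 : ℝ) ≤ L := L.2
  rw [lt_div_iff₀ (by positivity)] at hxε
  nlinarith [Metric.infDist_nonneg (x := x) (s := (D : Set (E n))ᶜ)]

lemma exists_lipschitzOnWith_norm_sub_pow (a : E n) {s : Set (E n)} (hs : Bornology.IsBounded s)
    (m : ℕ) : ∃ L : ℝ≥0, LipschitzOnWith L (fun x => ‖x - a‖ ^ m) s := by
  obtain ⟨R, hR⟩ := hs.subset_closedBall a
  refine ⟨m * (R.toNNReal) ^ (m - 1), LipschitzOnWith.of_dist_le_mul fun x hx y hy => ?_⟩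
  have h : ∀ z ∈ s, |‖z - a‖| ≤ R.toNNReal := fun z hz => by
    rw [abs_norm, ← dist_eq_norm]
    exact (Metric.mem_closedBall.1 (hR hz)).trans (Real.le_coe_toNNReal R)
  have h1 : |‖x - a‖ - ‖y - a‖| ≤ dist x y := by
    refine (abs_norm_sub_norm_le _ _).trans_eq ?_
    rw [sub_sub_sub_cancel_right, dist_eq_norm]
  calc dist (‖x - a‖ ^ m) (‖y - a‖ ^ m)
      ≤ |‖x - a‖ - ‖y - a‖| * m * max |‖x - a‖| |‖y - a‖| ^ (m - 1) := abs_pow_sub_pow_le ..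
    _ ≤ dist x y * m * (R.toNNReal : ℝ) ^ (m - 1) := by
        gcongr
        exact max_le (h x hx) (h y hy)
    _ = _ := by push_cast; ring

/-! ### Approximation by smooth functions -/

/-- Smooth bumps that tend to the indicator of the ball, divided by its volume, reproduce the mean
by dominated convergence. They stay below the indicator, so the total mass is at most one. -/
lemma exists_mollifier {f : E n → ℝ} (hf : LocallyIntegrable f) (a : E n) {r δ : ℝ} (hr : 0 < r)
    (hδ : 0 < δ) : ∃ κ : E n → ℝ, ContDiff ℝ ∞ κ ∧ (∀ y, 0 ≤ κ y) ∧
      tsupport κ ⊆ Metric.closedBall 0 r ∧ ∫ y, κ y ≤ 1 ∧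
      (⨍ y in Metric.ball a r, f y) - δ < mollify f κ a := by
  set c : ℝ := (volume.real (Metric.ball a r))⁻¹ with hc
  have hvol : 0 < volume.real (Metric.ball a r) :=
    ENNReal.toReal_pos (Metric.measure_ball_pos _ _ hr).ne' measure_ball_lt_top.ne
  have hc0 : 0 < c := inv_pos.2 hvol
  have hj : ∀ j : ℕ, (0 : ℝ) < 1 - 1 / (j + 2) ∧ (1 : ℝ) - 1 / (j + 2) < 1 := fun j => by
    have h1 : (1 : ℝ) / (j + 2) < 1 := (div_lt_one (by positivity)).2 (by
      have := j.cast_nonneg (α := ℝ); linarith)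
    have h2 : (0 : ℝ) < 1 / (j + 2) := by positivity
    constructor <;> linarith
  let b : ℕ → ContDiffBump (0 : E n) := fun j =>
    ⟨r * (1 - 1 / (j + 2)), r, mul_pos hr (hj j).1, mul_lt_of_lt_one_right hr (hj j).2⟩
  have hzero : ∀ j x, r ≤ ‖x‖ → b j x = 0 := fun j x hx =>
    (b j).zero_of_le_dist (by rwa [dist_zero_right])
  have hlim : Tendsto (fun j => ∫ y, f y * (c * b j (a - y))) atTop
      (𝓝 (∫ y, (Metric.ball a r).indicator (fun y => c * f y) y)) := by
    have hint : IntegrableOn (fun y => c * f y) (Metric.closedBall a r) :=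
      (hf.integrableOn_isCompact (isCompact_closedBall a r)).const_mul c
    refine tendsto_integral_of_dominated_convergence
      ((Metric.closedBall a r).indicator fun y => ‖c * f y‖) (fun j => ?_)
      ((integrable_indicator_iff measurableSet_closedBall).2 hint.norm) (fun j => ?_) ?_
    · exact hf.aestronglyMeasurable.mul (continuous_const.mul ((b j).continuous.comp
        (continuous_const.sub continuous_id))).aestronglyMeasurable
    · refine Eventually.of_forall fun y => ?_
      by_cases hy : y ∈ Metric.closedBall a r
      · rw [indicator_of_mem hy, ← mul_assoc, mul_comm (f y) c, norm_mul,
          Real.norm_of_nonneg (b j).nonneg]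
        exact mul_le_of_le_one_right (norm_nonneg _) (b j).le_one
      · rw [Metric.mem_closedBall', not_le, dist_eq_norm] at hy
        rw [hzero j _ hy.le, mul_zero, mul_zero, norm_zero]
        exact indicator_nonneg (fun _ _ => norm_nonneg _) _
    · refine Eventually.of_forall fun y => ?_
      by_cases hy : y ∈ Metric.ball a r
      · rw [indicator_of_mem hy]
        rw [Metric.mem_ball', dist_eq_norm] at hy
        have h1 : Tendsto (fun j : ℕ => r * (1 - 1 / ((j : ℝ) + 2))) atTop (𝓝 (r * (1 - 0))) := by
          refine (tendsto_const_nhds.sub ?_).const_mul r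
          have := (tendsto_const_div_atTop_nhds_zero_nat (1 : ℝ)).comp (tendsto_add_atTop_nat 2)
          refine this.congr fun j => ?_
          simp
        rw [sub_zero, mul_one] at h1
        refine tendsto_const_nhds.congr' ?_
        filter_upwards [h1.eventually (lt_mem_nhds hy)] with j hj
        rw [(b j).one_of_mem_closedBall (mem_closedBall_zero_iff.2 hj.le), mul_one, mul_comm]
      · rw [indicator_of_notMem hy]
        rw [Metric.mem_ball', not_lt, dist_eq_norm] at hy
        refine tendsto_const_nhds.congr fun j => ?_
        rw [hzero j _ hy, mul_zero, mul_zero]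
  have hmean : ∫ y, (Metric.ball a r).indicator (fun y => c * f y) y =
      ⨍ y in Metric.ball a r, f y := by
    rw [integral_indicator measurableSet_ball, integral_const_mul, setAverage_eq, smul_eq_mul]
  rw [hmean] at hlim
  obtain ⟨j, hj⟩ := (hlim.eventually (lt_mem_nhds (sub_lt_self _ hδ))).exists
  have hts : tsupport (fun y => c * b j y) ⊆ Metric.closedBall 0 r :=
    (tsupport_mul_subset_right (f := fun _ => c)).trans (b j).tsupport_eq.subset
  refine ⟨fun y => c * b j y, contDiff_const.mul (b j).contDiff, fun y =>
    mul_nonneg hc0.le (b j).nonneg, hts, ?_, hj⟩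
  calc ∫ y, c * b j y ≤ ∫ y, (Metric.ball (0 : E n) r).indicator (fun _ => c) y := by
        refine integral_mono ((b j).continuous.integrable_of_hasCompactSupport
          (b j).hasCompactSupport |>.const_mul c)
          ((integrable_indicator_iff measurableSet_ball).2
            (integrableOn_const measure_ball_lt_top.ne)) fun y => ?_
        by_cases hy : y ∈ Metric.ball (0 : E n) r
        · rw [indicator_of_mem hy]
          exact mul_le_of_le_one_right hc0.le (b j).le_one
        · rw [indicator_of_notMem hy]
          rw [mem_ball_zero_iff, not_lt] at hy
          simp only [hzero j y hy, mul_zero, le_refl]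
    _ = 1 := by
        rw [integral_indicator_const _ measurableSet_ball, smul_eq_mul, hc]
        rw [show volume.real (Metric.ball (0 : E n) r) = volume.real (Metric.ball a r) by
          simp only [Measure.real, Measure.addHaar_ball_center volume a r]]
        exact mul_inv_cancel₀ hvol.ne'

lemma ddSharp_sub_const {v : E n → ℝ} (hv : ContDiff ℝ ∞ v) (c : ℝ) (x : E n) :
    ddSharp (fun y => v y - c) x = ddSharp v x := by
  rw [ddSharp_eq_endForm_gradient hv, ddSharp_eq_endForm
    (fun y => (hasFDerivAt_gradient hv y).sub_const c)
    ((contDiff_gradient hv).differentiable (by simp))]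

/-- The function `v` is a mollification of `w` minus a constant. Near the boundary `w` is almost
below `g`, hence so is its mollification, and the constant makes the inequality exact. Farther
inside, the mollification uses values of `w` in `D` only, so the sign of `dd^# v ∧ β^k` is kept. -/
lemma exists_smooth_minorant {k : ℕ} {D : Opens (E n)} (hD : Bornology.IsBounded (D : Set (E n)))
    (hne : ((D : Set (E n))ᶜ).Nonempty) {a : E n} (ha : a ∈ D) {w g : E n → ℝ}
    (hg : Continuous g) (hg0 : ∀ x, 0 ≤ g x) (hwg : BoundaryLE D w g)
    (hint : LocallyIntegrableOn w (D : Set (E n)))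
    (hmean : Tendsto (fun r : ℝ => ⨍ y in Metric.ball a r, w y) (𝓝[>] 0) (𝓝 (w a)))
    (hpos : HasPositiveMollifications k D w) {c : ℝ} (hc : c < w a) :
    ∃ (v : E n → ℝ) (K : Set (E n)), ContDiff ℝ ∞ v ∧ IsCompact K ∧ K ⊆ D ∧ c < v a ∧
      (∀ x ∈ D, g x < v x → x ∈ K) ∧
      ∀ x ∈ K, ∀ α : Form n →ₗ[ℝ] ℝ, IsWeaklyPositiveForm (k + 1) α →
        0 ≤ α (ddSharp v x * beta n ^ k) := by
  set d : E n → ℝ := fun x => Metric.infDist x (D : Set (E n))ᶜ with hd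
  have hdc : Continuous d := Metric.continuous_infDist_pt _
  have hd1 : ∀ x y, d y ≤ d x + ‖y - x‖ := fun x y =>
    dist_eq_norm y x ▸ Metric.infDist_le_infDist_add_dist
  have hdD : ∀ x, 0 < d x → x ∈ D := fun x hx => by
    by_contra h
    exact hx.ne' (Metric.infDist_zero_of_mem (show x ∈ (D : Set (E n))ᶜ from h))
  have hcpt : ∀ t, 0 < t → IsCompact {x | t ≤ d x} := fun t ht =>
    Metric.isCompact_of_isClosed_isBounded (isClosed_le continuous_const hdc)
      (hD.subset fun x hx => hdD x (ht.trans_le hx))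
  -- Four losses at `a`: one in passing to the mean, one in smoothing the mean, and two in the
  -- subtracted constant. The last two pay for the boundary estimate and for the oscillation of `g`.
  set δ := (w a - c) / 4 with hδ
  have hδ0 : 0 < δ := by rw [hδ]; linarith
  obtain ⟨ε₀, hε₀, hε₀w⟩ := hwg δ hδ0
  have hda : 0 < d a := (D.isOpen.isClosed_compl.notMem_iff_infDist_pos hne).1 fun h => h ha
  -- Three layers: `w` is cut off at depth `ε`, the final compact set has depth `2 ε`, and a
  -- translate by less than `ε` of a point outside it has depth below `3 ε ≤ ε₀`. The point `a` has
  -- depth at least `3 ε`.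
  set ε := min ε₀ (d a) / 3 with hε
  have hε0 : 0 < ε := by rw [hε]; positivity
  have hεε₀ : 3 * ε ≤ ε₀ := by rw [hε]; linarith [min_le_left ε₀ (d a)]
  have hεa : 3 * ε ≤ d a := by rw [hε]; linarith [min_le_right ε₀ (d a)]
  set K' := {x | ε ≤ d x} with hK'
  have hK'c : IsCompact K' := hcpt ε hε0
  have hK'D : K' ⊆ D := fun x hx => hdD x (hε0.trans_le hx)
  have hball : ∀ x, 2 * ε ≤ d x → Metric.ball x ε ⊆ K' := fun x hx y hy => by
    rw [mem_ball_iff_norm'] at hy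
    change ε ≤ d y
    linarith [hd1 y x]
  obtain ⟨η, hη, hηg⟩ := Metric.uniformContinuousOn_iff_le.1
    ((Metric.isCompact_of_isClosed_isBounded Metric.isClosed_cthickening
      (hD.cthickening (δ := ε))).uniformContinuousOn_of_continuous hg.continuousOn) δ hδ0
  obtain ⟨r, ⟨hr0, hr⟩, hrm⟩ := (Filter.Eventually.and (Ioo_mem_nhdsGT (lt_min hε0 hη))
    (hmean.eventually (lt_mem_nhds (sub_lt_self (w a) hδ0)))).exists
  have hrε : r < ε := hr.trans_le (min_le_left _ _)
  -- The cutoff gives a function integrable on the whole space. It equals `w` on the `ε`-balls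
  -- around points of depth `2 ε`. Where it is zero it lies below `g + 2 δ` because `g ≥ 0`.
  set f := K'.indicator w with hf
  have hfi : LocallyIntegrable f := ((integrable_indicator_iff hK'c.measurableSet).2
    (hint.integrableOn_compact_subset hK'D hK'c)).locallyIntegrable
  have hfa : ⨍ y in Metric.ball a r, f y = ⨍ y in Metric.ball a r, w y := by
    refine setAverage_congr_fun measurableSet_ball (Eventually.of_forall fun y hy => ?_)
    exact indicator_of_mem (hball a (by linarith) (Metric.ball_subset_ball hrε.le hy)) w
  obtain ⟨κ, hκ, hκ0, hκr, hκ1, hκa⟩ := exists_mollifier hfi a hr0 hδ0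
  have hκc := hasCompactSupport_of_tsupport_subset hκr
  rw [hfa] at hκa
  have hv := contDiff_mollify hfi hκ hκc
  refine ⟨fun x => mollify f κ x - 2 * δ, {x | 2 * ε ≤ d x}, hv.sub contDiff_const,
    hcpt _ (by linarith), fun x hx => hdD x (by linarith [show 2 * ε ≤ d x from hx]), ?_, ?_, ?_⟩
  · change c < mollify f κ a - 2 * δ
    have : c = w a - 4 * δ := by rw [hδ]; ring
    linarith
  · intro x hx hlt
    by_contra hxK
    rw [mem_ofPred_eq, not_le] at hxK
    have hle : ∀ y, f (x - y) * κ y ≤ (g x + 2 * δ) * κ y := fun y => by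
      rcases eq_or_ne (κ y) 0 with h0 | h0
      · simp [h0]
      refine mul_le_mul_of_nonneg_right ?_ (hκ0 y)
      have hyr : ‖y‖ ≤ r := mem_closedBall_zero_iff.1 (hκr (subset_tsupport _ h0))
      by_cases hxy : x - y ∈ K'
      · rw [hf, indicator_of_mem hxy]
        have h1 := hd1 x (x - y)
        rw [sub_sub_cancel_left, norm_neg] at h1
        have h2 := hε₀w (x - y) (hK'D hxy) (by change d (x - y) < ε₀; linarith)
        have h3 := hηg (x - y) (Metric.self_subset_cthickening _ (hK'D hxy)) x
          (Metric.self_subset_cthickening _ hx) (by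
            rw [dist_eq_norm, sub_sub_cancel_left, norm_neg]
            exact hyr.trans (hr.le.trans (min_le_right _ _)))
        rw [Real.dist_eq] at h3
        linarith [(abs_le.1 h3).2]
      · rw [hf, indicator_of_notMem hxy]
        have := hg0 x
        positivity
    have hi : Integrable fun y => f (x - y) * κ y := by
      simpa using (integrable_mul_comp_sub hfi hκ.continuous hκc x).comp_sub_left x
    have : mollify f κ x ≤ g x + 2 * δ := by
      rw [mollify_apply_swap]
      calc ∫ y, f (x - y) * κ y ≤ ∫ y, (g x + 2 * δ) * κ y :=
            integral_mono hi ((hκ.continuous.integrable_of_hasCompactSupport hκc).const_mul _) hle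
        _ = (g x + 2 * δ) * ∫ y, κ y := integral_const_mul _ _
        _ ≤ g x + 2 * δ := mul_le_of_le_one_right (by have := hg0 x; positivity) hκ1
    linarith
  · intro x hx α hα
    rw [ddSharp_sub_const hv]
    exact hpos f κ x r ε hfi hκ hκ0 hκr hrε ((hball x hx).trans hK'D)
      (fun y hy => indicator_of_mem (hball x hx hy) w) α hα

/-! ### The density estimate -/

lemma Supercurrent.IsMinimal.ofReal_mul_density_le {k : ℕ} {D : Opens (E n)}
    {T : Supercurrent D (k + 1) (k + 1)} (hT : T.IsMinimal)
    (hD : Bornology.IsBounded (D : Set (E n))) (hne : ((D : Set (E n))ᶜ).Nonempty) {a : E n}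
    (ha : a ∈ D) {w : E n → ℝ}
    (hw : ConvexAlongSegments (closure (D : Set (E n))) w ∨ IsMSubharmonicOnClosure (k + 1) D w)
    (hbd : ∀ x ∈ frontier (D : Set (E n)), w x = ‖x - a‖ ^ (k + 1)) {γ : ℝ≥0}
    (hγ : T.HasDensity a γ) : ENNReal.ofReal (w a) * γ ≤ T.mass (D : Set (E n)) := by
  have hg : Continuous fun x : E n => ‖x - a‖ ^ (k + 1) := by fun_prop
  have key : ∀ c < w a, ENNReal.ofReal c * γ ≤ T.mass (D : Set (E n)) := fun c hc => by
    obtain ⟨v, K, hv, hK, hKD, hva, hvK, hpos⟩ :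
        ∃ (v : E n → ℝ) (K : Set (E n)), ContDiff ℝ ∞ v ∧ IsCompact K ∧ K ⊆ D ∧ c < v a ∧
          (∀ x ∈ D, ‖x - a‖ ^ (k + 1) < v x → x ∈ K) ∧
          ∀ x ∈ K, ∀ α : Form n →ₗ[ℝ] ℝ, IsWeaklyPositiveForm (k + 1) α →
            0 ≤ α (ddSharp v x * beta n ^ k) := by
      rcases hw with hw | hw
      · obtain ⟨L, hL⟩ := exists_lipschitzOnWith_norm_sub_pow a hD.closure (k + 1)
        exact exists_smooth_minorant hD hne ha hg (fun x => by positivity)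
          (boundaryLE_of_convexAlongSegments hD hne hw hL hbd)
          (hw.continuousOn.locallyIntegrableOn D.isOpen.measurableSet)
          (tendsto_setAverage_ball D.isOpen hw.continuousOn ha) hw.hasPositiveMollifications hc
      · exact exists_smooth_minorant hD hne ha hg (fun x => by positivity)
          (boundaryLE_of_upperSemicontinuousOn hD hne hw.upperSemicontinuous hg
            fun x hx => (hbd x hx).le)
          hw.mSubharmonic.1 (hw.tendsto_mean a ha) hw.mSubharmonic.hasPositiveMollifications hc
    exact hT.mul_density_le hv hD ha hK hKD hvK hpos hγ hva
  have hlim : Tendsto (fun c => ENNReal.ofReal c * γ) (𝓝[<] w a) (𝓝 (ENNReal.ofReal (w a) * γ)) :=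
    ENNReal.Tendsto.mul_const (ENNReal.continuous_ofReal.continuousAt.mono_left nhdsWithin_le_nhds)
      (Or.inr ENNReal.coe_ne_top)
  exact le_of_tendsto hlim (eventually_nhdsWithin_of_forall key)

/-- In dimension zero `β = 0`, and its power `k + 1` is positive. -/
lemma Supercurrent.mass_eq_zero_of_subsingleton {k : ℕ} {D : Opens (E 0)}
    (T : Supercurrent D (k + 1) (k + 1)) (U : Set (E 0)) : T.mass U = 0 := by
  refine le_antisymm (iSup_le fun χ => iSup_le fun φ => iSup_le fun _ => iSup_le fun _ =>
    iSup_le fun hφ => ?_) bot_le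
  have hφ0 : φ = 0 := TestFunction.ext fun x => Subtype.ext <| by
    rw [hφ x, beta, Finset.univ_eq_empty, Finset.sum_empty, zero_pow k.succ_ne_zero]
    simp
  rw [hφ0, map_zero, ENNReal.ofReal_zero]

end

end Super

theorem theorem6p3 (n m : ℕ) (hm : 1 ≤ m) (D : TopologicalSpace.Opens (Super.E n))
    (hD : Super.IsSmoothlyBoundedDomain D) (a : Super.E n) (ha : a ∈ D) (w : Super.E n → ℝ)
    (hw : Super.ConvexAlongSegments (closure (D : Set (Super.E n))) w ∨
      Super.IsMSubharmonicOnClosure m D w)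
    (hbd : ∀ x ∈ frontier (D : Set (Super.E n)), w x = ‖x - a‖ ^ m)
    (T : Super.Supercurrent D m m) (hT : T.IsMinimal) :
    ∃ γ : NNReal, T.HasDensity a γ ∧
      ENNReal.ofReal (w a) * (γ : ENNReal) ≤ T.mass (D : Set (Super.E n)) := by
  obtain ⟨k, rfl⟩ := Nat.exists_eq_add_of_le' hm
  obtain ⟨γ, hγ⟩ := hT.exists_hasDensity hD.bounded ha
  refine ⟨γ, hγ, ?_⟩
  -- In dimension zero `D` is the whole space, so there is no boundary to use, but mass and density
  -- vanish. In positive dimension the complement is nonempty because the space is unbounded.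
  rcases Nat.eq_zero_or_pos n with rfl | hn
  · have hγ0 : γ = 0 := by
      have h : Filter.Tendsto
          (fun r : ℝ => T.mass (Metric.ball a r) / ENNReal.ofReal (r ^ (k + 1)))
          (nhdsWithin 0 (Set.Ioi 0)) (nhds (γ : ENNReal)) := hγ
      simp only [T.mass_eq_zero_of_subsingleton, ENNReal.zero_div] at h
      exact ENNReal.coe_eq_zero.1 (tendsto_nhds_unique h tendsto_const_nhds)
    simp [hγ0]
  · have : Nonempty (Fin n) := ⟨⟨0, hn⟩⟩
    refine hT.ofReal_mul_density_le hD.bounded ?_ ha hw hbd hγ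
    rw [Set.nonempty_compl]
    intro h
    exact NormedSpace.unbounded_univ ℝ (Super.E n) (h ▸ hD.bounded)
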